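/- Let $m\ge 1$ be an integer, $\mathbb H$ the upper half-plane and, for $\tau\in\mathbb H$, $y=\operatorname{Im}\tau$. Put $E(x)=2\int_0^x e^{-\pi t^2}\,dt$. For $l\in\mathbb Z$, $u,z\in\mathbb C$ and $\tau\in\mathbb H$ define $$f_u(z;\tau)=\sum_{\lambda\in\mathbb Z}\frac{e^{2\pi i m\lambda^2\tau+4\pi i m\lambda z}}{1-e^{2\pi i\lambda\tau+2\pi i(z-u)}}\quad(z\notin u+\mathbb Z\tau+\mathbb Z),\qquad \theta_{m,l}(z;\tau)=\sum_{\lambda\equiv l\,(2m)}e^{\pi i\lambda^2\tau/2m+2\pi i\lambda z},$$ $$R_{m,l}(u;\tau)=\sum_{\lambda\equiv l\,(2m)}\Bigl\{\operatorname{sign}\bigl(\lambda+\tfrac12\bigr)-E\Bigl(\bigl(\lambda+2m\operatorname{Im}(u)/y\bigr)\sqrt{y/m}\Bigr)\Bigr\}e^{-\pi i\lambda^2\tau/2m-2\pi i\lambda u},$$ $$\tilde f_u(z;\tau)=f_u(z;\tau)-\tfrac12\sum_{l\bmod 2m}R_{m,l}(u;\tau)\,\theta_{m,l}(z;\tau).$$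 These series converge absolutely, and the following hold. (1) $\tilde f_u(z;\tau)$ transforms like a two-variable Jacobi form of weight $1$ and index $\operatorname{diag}(2m,-2m)$ in $(z,u)$; that is, for all $u,z\in\mathbb C$, $\tau\in\mathbb H$ with $z\notin u+\mathbb Z\tau+\mathbb Z$: (a) $\tilde f_u(z+\lambda\tau+\mu;\tau)=e^{-2\pi i m(\lambda^2\tau+2\lambda z)}\tilde f_u(z;\tau)$ for all $\lambda,\mu\in\mathbb Z$; (b) $\tilde f_{u+\lambda\tau+\mu}(z;\tau)=e^{2\pi i m(\lambda^2\tau+2\lambda u)}\tilde f_u(z;\tau)$ for all $\lambda,\mu\in\mathbb Z$; (c) $\displaystyle \tilde f_{\frac{u}{c\tau+d}}\Bigl(\frac{z}{c\tau+d};\frac{a\tau+b}{c\tau+d}\Bigr)=(c\tau+d)\,e^{2\pi i m c(z^2-u^2)/(c\tau+d)}\,\tilde f_u(z;\tau)$ for all $\begin{pmatrix}a&b\\c&d\end{pmatrix}\in\mathrm{SL}_2(\mathbb Z)$. (2) For fixed $u\in\mathbb C$ and $\tau\in\mathbb H$, the function $z\mapsto\tilde f_u(z;\tau)$ is meromorphic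 on $\mathbb C$, with simple poles at the points of $u+\mathbb Z\tau+\mathbb Z$ and no other poles, and its residue at $z=u$ is $-\frac1{2\pi i}$. (3) Let $A$ be a symmetric non-degenerate integral $r\times r$-matrix, $B(x,y)=\langle x,Ay\rangle$ and $Q(x)=\frac12B(x,x)$, and suppose that $Q$ has type $(r-1,1)$, i.e. the largest dimension of a real subspace on which $Q$ is negative definite is $1$. Let $C_Q$ be the component of $\{c\in\mathbb R^r: Q(c)<0\}$ containing a given vector $c_0$, that is $C_Q=\{c: Q(c)<0,\ B(c,c_0)<0\}$, and let $S_Q$ be the set of primitive $c\in\mathbb Z^r$ with $Q(c)=0$ and $B(c,c_0)<0$. Let $D(c)=\mathbb C^r\times\mathbb H$ for $c\in C_Q$ and $D(c)=\{(z,\tau): B(c,\operatorname{Im}(z)/y)\notin\mathbb Z\}$ for $c\in S_Q$. For $c_1,c_2\in C_Q\cup S_Q$ and $(z,\tau)\in D(c_1)\cap D(c_2)$ put $$\theta_A^{c_1,c_2}(z;\tau)=\sum_{n\in\mathbb Z^r}\bigl(\rho^{c_1}(n+a;\tau)-\rho^{c_2}(n+a;\tau)\bigr)e^{2\pi iQ(n)\tau+2\pi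 iB(n,z)},\qquad a=\operatorname{Im}(z)/y,$$ where $\rho^c(\nu;\tau)=E\bigl(\tfrac{B(c,\nu)}{\sqrt{-Q(c)}}y^{1/2}\bigr)$ if $c\in C_Q$ and $\rho^c(\nu;\tau)=\operatorname{sign}(B(c,\nu))$ if $c\in S_Q$. Now take $A=\begin{pmatrix}2m&1\\1&0\end{pmatrix}$, $c_1=\begin{pmatrix}0\\1\end{pmatrix}$, $c_2=\begin{pmatrix}-1\\2m\end{pmatrix}$. Then $A$ is symmetric and non-degenerate, $Q$ has type $(1,1)$, and, for the component $C_Q$ with $c_0=c_2$, one has $c_1\in S_Q$ and $c_2\in C_Q$. For $u,z\in\mathbb C$ and $\tau\in\mathbb H$, the point $\bigl(\binom{z-u}{2mu},\tau\bigr)$ lies in $D(c_1)\cap D(c_2)$ if and only if $\operatorname{Im}(z-u)/y\notin\mathbb Z$, and in that case the series for $\theta_A^{c_1,c_2}$ converges absolutely there and $$\tilde f_u(z;\tau)=\tfrac12\,\theta_A^{c_1,c_2}\Bigl(\binom{z-u}{2mu};\tau\Bigr).$$ -/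

import Mathlib

open scoped UpperHalfPlane MatrixGroups Topology

namespace MockTheta

noncomputable section

/-! ### The building block -/

/-- The function `E(x) = 2 ∫₀ˣ exp (-π t²) dt`, at real arguments. -/
def E (x : ℝ) : ℝ := 2 * ∫ t in (0 : ℝ)..x, Real.exp (-Real.pi * t ^ 2)

/-- The lattice coset `u + ℤτ + ℤ`. -/
def latticeCoset (u : ℂ) (τ : ℍ) : Set ℂ := {z | ∃ k n : ℤ, z = u + k * (τ : ℂ) + n}

/-- The `k`-th term of the series `f_u(z;τ)`. -/
def fTerm (m : ℕ) (u z : ℂ) (τ : ℍ) (k : ℤ) : ℂ :=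
  Complex.exp (2 * Real.pi * Complex.I * m * k ^ 2 * τ + 4 * Real.pi * Complex.I * m * k * z) /
    (1 - Complex.exp (2 * Real.pi * Complex.I * k * τ + 2 * Real.pi * Complex.I * (z - u)))

/-- The function `f_u(z;τ) = ∑_k exp (2πimk²τ + 4πimkz) / (1 - exp (2πikτ + 2πi(z-u)))`,
meaningful for `z ∉ u + ℤτ + ℤ`. -/
def f (m : ℕ) (u z : ℂ) (τ : ℍ) : ℂ := ∑' k : ℤ, fTerm m u z τ k

/-- The term of `θ_{m,l}(z;τ)` with index `k ≡ l mod 2m`. -/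
def thetaTerm (m : ℕ) (z : ℂ) (τ : ℍ) (k : ℤ) : ℂ :=
  Complex.exp (Real.pi * Complex.I * k ^ 2 * τ / (2 * m) + 2 * Real.pi * Complex.I * k * z)

/-- `θ_{m,l}(z;τ) = ∑_{k ≡ l mod 2m} exp (πik²τ/2m + 2πikz)`. -/
def thetaML (m : ℕ) (l : ℤ) (z : ℂ) (τ : ℍ) : ℂ :=
  ∑' k : {k : ℤ // k ≡ l [ZMOD (2 * m : ℤ)]}, thetaTerm m z τ k

/-- The term of `R_{m,l}(u;τ)` with index `k ≡ l mod 2m`. -/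
def RTerm (m : ℕ) (u : ℂ) (τ : ℍ) (k : ℤ) : ℂ :=
  ((Real.sign ((k : ℝ) + 1 / 2) -
      E (((k : ℝ) + 2 * m * u.im / τ.im) * Real.sqrt (τ.im / m)) : ℝ) : ℂ) *
    Complex.exp (-(Real.pi * Complex.I * k ^ 2 * τ / (2 * m)) - 2 * Real.pi * Complex.I * k * u)

/-- `R_{m,l}(u;τ) = ∑_{k ≡ l mod 2m}
  {sign (k + 1/2) - E ((k + 2m Im u / y) √(y/m))} exp (-πik²τ/2m - 2πiku)`, `y = Im τ`. -/
def RML (m : ℕ) (l : ℤ) (u : ℂ) (τ : ℍ) : ℂ :=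
  ∑' k : {k : ℤ // k ≡ l [ZMOD (2 * m : ℤ)]}, RTerm m u τ k

/-- The completed building block `f̃_u(z;τ) = f_u(z;τ) - ½ ∑_{l mod 2m} R_{m,l}(u;τ) θ_{m,l}(z;τ)`,
the residues modulo `2m` being represented by `0, …, 2m - 1`. -/
def fTilde (m : ℕ) (u z : ℂ) (τ : ℍ) : ℂ :=
  f m u z τ - (1 / 2) * ∑ l ∈ Finset.range (2 * m), RML m l u τ * thetaML m l z τ

/-! ### Indefinite theta functions -/

variable {r : ℕ}

/-- The bilinear form `B(x,y) = ⟨x, A y⟩` of an integral matrix `A`, over a field `K`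
(`K` is `ℝ` or `ℂ`). -/
def bilB {K : Type} [Field K] (A : Matrix (Fin r) (Fin r) ℤ) (x y : Fin r → K) : K :=
  x ⬝ᵥ (A.map (fun n : ℤ => (n : K))).mulVec y

/-- The quadratic form `Q(x) = ½ ⟨x, A x⟩`. -/
def quadQ {K : Type} [Field K] (A : Matrix (Fin r) (Fin r) ℤ) (x : Fin r → K) : K :=
  (1 / 2) * bilB A x x

/-- `A` is symmetric and non-degenerate and its quadratic form has type `(r - 1, 1)`: the largest
dimension of a real subspace on which `Q` is negative definite is `1`. -/
def IsOfTypeOne (A : Matrix (Fin r) (Fin r) ℤ) : Prop :=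
  A.IsSymm ∧ A.det ≠ 0 ∧
    IsGreatest {d : ℕ | ∃ W : Submodule ℝ (Fin r → ℝ), Module.finrank ℝ W = d ∧
      ∀ x ∈ W, x ≠ 0 → quadQ A x < 0} 1

/-- The component `C_Q` of `{Q < 0}` that contains `c₀` (where `Q(c₀) < 0`). -/
def coneC (A : Matrix (Fin r) (Fin r) ℤ) (c₀ : Fin r → ℝ) : Set (Fin r → ℝ) :=
  {c | quadQ A c < 0 ∧ bilB A c c₀ < 0}

/-- The set `S_Q` of primitive integral vectors `c` with `Q(c) = 0` and `B(c,c₀) < 0`. -/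
def cuspS (A : Matrix (Fin r) (Fin r) ℤ) (c₀ : Fin r → ℝ) : Set (Fin r → ℝ) :=
  {c | (∃ n : Fin r → ℤ, Finset.univ.gcd n = 1 ∧ c = fun i => (n i : ℝ)) ∧
    quadQ A c = 0 ∧ bilB A c c₀ < 0}

/-- The domain `D(c)`, for `c ∈ C_Q ∪ S_Q`: all pairs `(z,τ)` if `c ∈ C_Q` (that is, `Q(c) < 0`),
and the pairs with `B(c, Im z / Im τ) ∉ ℤ` if `c ∈ S_Q` (that is, `Q(c) = 0`). -/
def domainD (A : Matrix (Fin r) (Fin r) ℤ) (c : Fin r → ℝ) : Set ((Fin r → ℂ) × ℍ) :=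
  {p | quadQ A c < 0 ∨ ∀ n : ℤ, bilB A c (fun i => (p.1 i).im / p.2.im) ≠ n}

open Classical in
/-- `ρ^c(ν;τ)`, for `c ∈ C_Q ∪ S_Q`: it is `E (B(c,ν) / √(-Q(c)) · √y)` if `c ∈ C_Q`
(that is, `Q(c) < 0`), and `sign B(c,ν)` if `c ∈ S_Q` (that is, `Q(c) = 0`). -/
def rhoC (A : Matrix (Fin r) (Fin r) ℤ) (c ν : Fin r → ℝ) (τ : ℍ) : ℝ :=
  if quadQ A c < 0 then E (bilB A c ν / Real.sqrt (-quadQ A c) * Real.sqrt τ.im)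
  else Real.sign (bilB A c ν)

/-- `ρ^{c₁,c₂} = ρ^{c₁} - ρ^{c₂}`. -/
def rho (A : Matrix (Fin r) (Fin r) ℤ) (c₁ c₂ ν : Fin r → ℝ) (τ : ℍ) : ℝ :=
  rhoC A c₁ ν τ - rhoC A c₂ ν τ

/-- The term with index `n ∈ ℤ^r` of `θ_A^{c₁,c₂}(z;τ)`. -/
def indefThetaTerm (A : Matrix (Fin r) (Fin r) ℤ) (c₁ c₂ : Fin r → ℝ) (z : Fin r → ℂ) (τ : ℍ)
    (n : Fin r → ℤ) : ℂ :=
  ((rho A c₁ c₂ (fun i => (n i : ℝ) + (z i).im / τ.im) τ : ℝ) : ℂ) *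
    Complex.exp (2 * Real.pi * Complex.I * quadQ A (fun i => (n i : ℂ)) * τ +
      2 * Real.pi * Complex.I * bilB A (fun i => (n i : ℂ)) z)

/-- `θ_A^{c₁,c₂}(z;τ) = ∑_{n ∈ ℤ^r} ρ(n + a; τ) exp (2πi Q(n) τ + 2πi B(n,z))`,
`a = Im z / Im τ`, for `(z,τ) ∈ D(c₁) ∩ D(c₂)`. -/
def indefTheta (A : Matrix (Fin r) (Fin r) ℤ) (c₁ c₂ : Fin r → ℝ) (z : Fin r → ℂ) (τ : ℍ) : ℂ :=
  ∑' n : Fin r → ℤ, indefThetaTerm A c₁ c₂ z τ n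

/-- The matrix `A = (2m 1; 1 0)`. -/
def blockA (m : ℕ) : Matrix (Fin 2) (Fin 2) ℤ := !![2 * (m : ℤ), 1; 1, 0]

/-- The vector `c₁ = (0, 1)`. -/
def blockC₁ : Fin 2 → ℝ := ![0, 1]

/-- The vector `c₂ = (-1, 2m)`. -/
def blockC₂ (m : ℕ) : Fin 2 → ℝ := ![-1, 2 * (m : ℝ)]

end

end MockTheta

namespace MockTheta

/-! The series `f` is elliptic in `z` term by term. In `u` it is not: replacing `u` by `u + τ`
multiplies each numerator by a `2m`-th power of the exponential in the denominator, and division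
leaves a finite geometric sum, that is, a combination of the `2m` functions `thetaML`
(`f_add_tau_u`). The sign in `RML` jumps exactly once in each residue class under the same shift and
produces twice these terms (`RML_add_tau`), so the factor `1/2` makes them cancel in `fTilde`. Poles
in `z` come from `f` alone, and near a given lattice point from a single term of it.

The modular law is proved on generators. For `T` the phases of `RML` and `thetaML` are inverse to
each other. For `S`, consider `inversionDefect` as a function of `u`. The only non-holomorphic
ingredient of `fTilde` is `E`, whose derivative is a Gaussian; hence the antiholomorphic derivative
of `fTilde` is an explicit factor times the kernel `thetaKernel`, the sum of conjugate theta
functions in `u` times theta functions in `z`. The functional equation of `jacobiTheta₂` and the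
orthogonality of characters modulo `2m` give `thetaKernel_inversion`, so the antiholomorphic
derivative of the defect vanishes. Its residues cancel too, so it extends to an entire function, and
this function has negative index in `u`. Such a function is bounded by quasi-periodicity, hence
constant by Liouville, hence zero (`eq_zero_of_negative_index`).

For the indefinite theta series, add and subtract `sign (n + 1/2)` in the weight `sign + E`. The
part with two signs is, for fixed first index, the geometric expansion of `2 / (1 - w)` in the
direction that converges, and sums to `2 f` (`hasSum_sign_geometric`); the other part regroups by
residues into the sum of `RML * thetaML` (`tsum_RTerm_mul_thetaTerm`). -/

open Complex in
theorem thetaTerm_eq (m : ℕ) (z : ℂ) (τ : ℍ) (k : ℤ) :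
    thetaTerm m z τ k = jacobiTheta₂_term k z (τ / (2 * m)) := by
  unfold thetaTerm jacobiTheta₂_term
  congr 1
  ring

theorem fTerm_eq (m : ℕ) (u z : ℂ) (τ : ℍ) (k : ℤ) :
    fTerm m u z τ k = jacobiTheta₂_term k (2 * m * z) (2 * m * τ) /
      (1 - Complex.exp (2 * Real.pi * Complex.I * k * τ + 2 * Real.pi * Complex.I * (z - u))) := by
  unfold fTerm jacobiTheta₂_term
  congr 2
  ring

theorem im_div_two_mul_nat (m : ℕ) (τ : ℂ) : (τ / (2 * m)).im = τ.im / (2 * m) := by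
  have : τ / (2 * m) = τ / ((2 * m : ℝ) : ℂ) := by push_cast; rfl
  rw [this, Complex.div_ofReal_im]

theorem im_two_mul_nat_mul (m : ℕ) (τ : ℂ) : (2 * m * τ).im = 2 * m * τ.im := by
  have : 2 * m * τ = ((2 * m : ℝ) : ℂ) * τ := by push_cast; rfl
  rw [this, Complex.im_ofReal_mul]

theorem summable_thetaTerm {m : ℕ} (hm : 0 < m) (z : ℂ) (τ : ℍ) : Summable (thetaTerm m z τ) := by
  have h : 0 < ((τ : ℂ) / (2 * m)).im := by
    rw [im_div_two_mul_nat]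
    have := τ.im_pos
    positivity
  exact ((summable_jacobiTheta₂_term_iff z _).mpr h).congr fun k => (thetaTerm_eq m z τ k).symm

theorem norm_thetaTerm_le {m : ℕ} (hm : 0 < m) {z : ℂ} (τ : ℍ) {S : ℝ} (hS : |z.im| ≤ S) (k : ℤ) :
    ‖thetaTerm m z τ k‖ ≤ Real.exp (-Real.pi * (τ.im / (2 * m) * k ^ 2 - 2 * S * |k|)) := by
  have := τ.im_pos
  rw [thetaTerm_eq]
  exact norm_jacobiTheta₂_term_le (by positivity) hS (im_div_two_mul_nat m τ).ge k

/-- The power `j = 0` majorizes the terms of `R`; `j = 1` is needed for their derivatives in `u`,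
which bring down a factor `k`. -/
theorem summable_gaussian_bound {m : ℕ} (hm : 0 < m) (τ : ℍ) (S : ℝ) (j : ℕ) :
    Summable fun k : ℤ =>
      (|k| ^ j : ℝ) * Real.exp (-Real.pi * (τ.im / (2 * m) * k ^ 2 - 2 * S * |k|)) := by
  have := τ.im_pos
  exact_mod_cast summable_pow_mul_jacobiTheta₂_term_bound S (T := τ.im / (2 * m)) (by positivity) j

/-! ### The denominators of `f` -/

theorem norm_exp_lattice (u z : ℂ) (τ : ℍ) (k : ℤ) :
    ‖Complex.exp (2 * Real.pi * Complex.I * k * τ + 2 * Real.pi * Complex.I * (z - u))‖ =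
      Real.exp (-(2 * Real.pi * (k * τ.im + (z - u).im))) := by
  rw [Complex.norm_exp]
  congr 1
  simp
  ring

/-- The margin `1` in `hk` keeps the exponential away from the unit circle: its modulus is at most
`1/2` for positive `k` and at least `2` for negative `k`. -/
theorem half_le_norm_one_sub {u z : ℂ} (τ : ℍ) {M : ℝ} (hM : |(z - u).im| ≤ M) {k : ℤ}
    (hk : M + 1 ≤ |(k : ℝ)| * τ.im) :
    1 / 2 ≤ ‖1 - Complex.exp
      (2 * Real.pi * Complex.I * k * τ + 2 * Real.pi * Complex.I * (z - u))‖ := by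
  have hpi := Real.pi_gt_three
  obtain ⟨h1, h2⟩ := abs_le.mp hM
  have hn := norm_exp_lattice u z τ k
  rcases abs_cases (k : ℝ) with ⟨h, -⟩ | ⟨h, -⟩ <;> rw [h] at hk
  · have h3 : Real.exp (-(2 * Real.pi * (k * τ.im + (z - u).im))) ≤ 1 / 2 := by
      rw [Real.exp_neg, one_div]
      apply inv_anti₀ two_pos
      refine le_trans ?_ (Real.add_one_le_exp _)
      nlinarith
    have := norm_sub_norm_le (1 : ℂ) (Complex.exp
      (2 * Real.pi * Complex.I * k * τ + 2 * Real.pi * Complex.I * (z - u)))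
    rw [norm_one] at this
    linarith
  · have h3 : 2 ≤ Real.exp (-(2 * Real.pi * (k * τ.im + (z - u).im))) := by
      refine le_trans ?_ (Real.add_one_le_exp _)
      nlinarith
    have := norm_sub_norm_le (Complex.exp
      (2 * Real.pi * Complex.I * k * τ + 2 * Real.pi * Complex.I * (z - u))) (1 : ℂ)
    rw [norm_one, norm_sub_rev] at this
    linarith

theorem exists_finset_half_le (τ : ℍ) (M : ℝ) : ∃ s : Finset ℤ, ∀ k ∉ s,
    M + 1 ≤ |(k : ℝ)| * τ.im := by
  have hy := τ.im_pos
  obtain ⟨N, hN⟩ := exists_nat_ge ((M + 1) / τ.im)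
  refine ⟨Finset.Icc (-(N : ℤ)) N, fun k hk => ?_⟩
  rw [div_le_iff₀ hy] at hN
  refine hN.trans (mul_le_mul_of_nonneg_right ?_ hy.le)
  have : (N : ℤ) ≤ |k| := by
    by_contra! h
    exact hk (Finset.mem_Icc.mpr (abs_le.mp h.le))
  exact_mod_cast this

/-- Off a finite set of indices, the terms of `f` are bounded on bounded sets by a summable
sequence. -/
theorem exists_bound_fTerm {m : ℕ} (hm : 0 < m) (τ : ℍ) (M : ℝ) :
    ∃ (s : Finset ℤ) (b : ℤ → ℝ), Summable b ∧ ∀ u z : ℂ, |u.im| ≤ M → |z.im| ≤ M → ∀ k ∉ s,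
      1 - Complex.exp (2 * Real.pi * Complex.I * k * τ + 2 * Real.pi * Complex.I * (z - u)) ≠ 0 ∧
      ‖fTerm m u z τ k‖ ≤ b k := by
  obtain ⟨s, hs⟩ := exists_finset_half_le τ (M + M)
  have hy := τ.im_pos
  have hT : 0 < 2 * m * τ.im := by positivity
  refine ⟨s, fun k => 2 * Real.exp (-Real.pi * ((2 * m * τ.im) * k ^ 2 - 2 * (2 * m * M) * |k|)),
    ?_, ?_⟩
  · have := summable_pow_mul_jacobiTheta₂_term_bound (2 * m * M) hT 0
    simpa using this.mul_left 2
  · intro u z hu hz k hk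
    have hd : |(z - u).im| ≤ M + M := by
      rw [Complex.sub_im]
      exact (abs_sub _ _).trans (add_le_add hz hu)
    have h1 := half_le_norm_one_sub τ hd (hs k hk)
    refine ⟨fun h0 => ?_, ?_⟩
    · rw [h0, norm_zero] at h1
      linarith
    · rw [fTerm_eq, norm_div]
      have h2 : ‖jacobiTheta₂_term k (2 * m * z) (2 * m * τ)‖ ≤
          Real.exp (-Real.pi * ((2 * m * τ.im) * k ^ 2 - 2 * (2 * m * M) * |k|)) := by
        refine norm_jacobiTheta₂_term_le hT ?_ (im_two_mul_nat_mul m τ).ge k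
        rw [im_two_mul_nat_mul, abs_mul, abs_of_nonneg (by positivity : (0:ℝ) ≤ 2 * m)]
        exact mul_le_mul_of_nonneg_left hz (by positivity)
      rw [div_le_iff₀ (by linarith)]
      have h3 := Real.exp_pos (-Real.pi * ((2 * m * τ.im) * k ^ 2 - 2 * (2 * m * M) * |k|))
      nlinarith

/-- Lattice points are not excluded: a vanishing denominator occurs only at one of the finitely many
exceptional indices, where division by zero gives the term `0`. -/
theorem summable_fTerm {m : ℕ} (hm : 0 < m) (u z : ℂ) (τ : ℍ) : Summable (fTerm m u z τ) := by
  obtain ⟨s, b, hb, h⟩ := exists_bound_fTerm hm τ (max |u.im| |z.im|)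
  refine Summable.of_norm_bounded_eventually hb ?_
  filter_upwards [s.finite_toSet.compl_mem_cofinite] with k hk
  exact (h u z (le_max_left _ _) (le_max_right _ _) k hk).2

theorem one_sub_exp_ne_zero {u z : ℂ} {τ : ℍ} (h : z ∉ latticeCoset u τ) (k : ℤ) :
    1 - Complex.exp (2 * Real.pi * Complex.I * k * τ + 2 * Real.pi * Complex.I * (z - u)) ≠ 0 := by
  intro h0
  rw [sub_eq_zero, eq_comm, Complex.exp_eq_one_iff] at h0
  obtain ⟨n, hn⟩ := h0
  refine h ⟨-k, n, ?_⟩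
  have h2 : (k : ℂ) * τ + (z - u) = n :=
    mul_left_cancel₀ Complex.two_pi_I_ne_zero (by linear_combination hn)
  push_cast
  linear_combination h2

/-! ### The error function and the terms of `R` -/

theorem hasDerivAt_E (x : ℝ) : HasDerivAt E (2 * Real.exp (-Real.pi * x ^ 2)) x := by
  have hc : Continuous fun t : ℝ => Real.exp (-Real.pi * t ^ 2) := by fun_prop
  exact (hc.integral_hasStrictDerivAt 0 x).hasDerivAt.const_mul 2

theorem E_neg (x : ℝ) : E (-x) = -E x := by
  unfold E
  have h := intervalIntegral.integral_comp_neg (a := 0) (b := x)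
    (fun t : ℝ => Real.exp (-Real.pi * t ^ 2))
  simp only [neg_sq, neg_zero] at h
  rw [h, intervalIntegral.integral_symm]
  ring

theorem tendsto_E_atTop : Filter.Tendsto E Filter.atTop (𝓝 1) := by
  have h := integral_gaussian_Ioi Real.pi
  rw [div_self Real.pi_ne_zero, Real.sqrt_one] at h
  have h2 := (MeasureTheory.intervalIntegral_tendsto_integral_Ioi 0
    (integrable_exp_neg_mul_sq Real.pi_pos).integrableOn Filter.tendsto_id).const_mul 2
  rw [h] at h2
  rw [mul_one_div_cancel two_ne_zero] at h2
  exact h2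

theorem strictMono_E : StrictMono E :=
  strictMono_of_hasDerivAt_pos hasDerivAt_E fun x => by positivity

theorem E_lt_one (x : ℝ) : E x < 1 := by
  have h1 : E x < E (x + 1) := strictMono_E (by linarith)
  exact h1.trans_le (strictMono_E.monotone.ge_of_tendsto tendsto_E_atTop _)

/-- For `t, x ≥ 0` one has `(t + x)² ≥ t² + x²`, so the tail of the Gaussian integral beyond `x` is
at most `exp (-πx²)` times the whole half-line integral. -/
theorem one_sub_E_le {x : ℝ} (hx : 0 ≤ x) : 1 - E x ≤ Real.exp (-Real.pi * x ^ 2) := by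
  have hc : Continuous fun t : ℝ => Real.exp (-Real.pi * t ^ 2) := by fun_prop
  have key : ∀ r : ℝ, 0 ≤ r → E (r + x) - E x ≤ Real.exp (-Real.pi * x ^ 2) := by
    intro r hr
    have h1 : E (r + x) - E x = 2 * ∫ t in (0 : ℝ)..r, Real.exp (-Real.pi * (t + x) ^ 2) := by
      rw [intervalIntegral.integral_comp_add_right (fun t : ℝ => Real.exp (-Real.pi * t ^ 2)),
        zero_add, ← intervalIntegral.integral_interval_sub_left (hc.intervalIntegrable 0 (r + x))
          (hc.intervalIntegrable 0 x)]
      unfold E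
      ring
    have h2 : ∫ t in (0 : ℝ)..r, Real.exp (-Real.pi * (t + x) ^ 2) ≤
        ∫ t in (0 : ℝ)..r, Real.exp (-Real.pi * x ^ 2) * Real.exp (-Real.pi * t ^ 2) := by
      refine intervalIntegral.integral_mono_on hr
        (Continuous.intervalIntegrable (by fun_prop) _ _)
        (Continuous.intervalIntegrable (by fun_prop) _ _) fun t ht => ?_
      rw [← Real.exp_add, Real.exp_le_exp]
      have := mul_nonneg Real.pi_pos.le (mul_nonneg ht.1 hx)
      nlinarith
    rw [intervalIntegral.integral_const_mul] at h2
    have h3 : 2 * ∫ t in (0 : ℝ)..r, Real.exp (-Real.pi * t ^ 2) ≤ 1 := (E_lt_one r).le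
    have h4 := Real.exp_pos (-Real.pi * x ^ 2)
    nlinarith
  have hlim : Filter.Tendsto (fun r => E (r + x) - E x) Filter.atTop (𝓝 (1 - E x)) :=
    (tendsto_E_atTop.comp (Filter.tendsto_atTop_add_const_right _ x Filter.tendsto_id)).sub_const _
  refine le_of_tendsto hlim ?_
  filter_upwards [Filter.eventually_ge_atTop 0] with r hr using key r hr

theorem one_sub_E_le_of_neg_le {x X : ℝ} (hx : -X ≤ x) :
    1 - E x ≤ 2 * Real.exp (Real.pi * X ^ 2) * Real.exp (-Real.pi * x ^ 2) := by
  have hpi := Real.pi_pos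
  rcases le_total 0 x with h | h
  · refine (one_sub_E_le h).trans (le_mul_of_one_le_left (Real.exp_pos _).le ?_)
    have := Real.one_le_exp (x := Real.pi * X ^ 2) (by positivity)
    linarith
  · have h1 := E_lt_one (-x)
    rw [E_neg] at h1
    have h2 : 1 ≤ Real.exp (Real.pi * X ^ 2) * Real.exp (-Real.pi * x ^ 2) := by
      rw [← Real.exp_add]
      refine Real.one_le_exp ?_
      have : x ^ 2 ≤ X ^ 2 := sq_le_sq' hx (by linarith)
      nlinarith
    linarith

theorem sign_int_add_half (k : ℤ) : Real.sign ((k : ℝ) + 1 / 2) = if 0 ≤ k then 1 else -1 := by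
  split_ifs with h
  · have : (0 : ℝ) ≤ k := by exact_mod_cast h
    exact Real.sign_of_pos (by linarith)
  · have : (k : ℝ) ≤ -1 := by exact_mod_cast (by lia : k ≤ -1)
    exact Real.sign_of_neg (by linarith)

/-- Since `E` is odd, negative `k` reduces to the case `k ≥ 0`. The shift `a` can push `k + a` to
the wrong side of zero by at most `A`, which costs only a constant factor. -/
theorem abs_sign_sub_E_le {c a A : ℝ} (hc : 0 ≤ c) (ha : |a| ≤ A) (k : ℤ) :
    |Real.sign ((k : ℝ) + 1 / 2) - E ((k + a) * c)| ≤
      2 * Real.exp (Real.pi * (A * c) ^ 2) * Real.exp (-Real.pi * ((k + a) * c) ^ 2) := by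
  obtain ⟨h1, h2⟩ := abs_le.mp ha
  rw [sign_int_add_half]
  split_ifs with h
  · have hk : (0 : ℝ) ≤ k := by exact_mod_cast h
    rw [abs_of_pos (by linarith [E_lt_one ((k + a) * c)])]
    refine one_sub_E_le_of_neg_le ?_
    rw [← neg_mul]
    exact mul_le_mul_of_nonneg_right (by linarith) hc
  · have hk : (k : ℝ) ≤ -1 := by exact_mod_cast (by lia : k ≤ -1)
    have h3 := E_lt_one (-((k + a) * c))
    have h4 : 1 - E (-((k + a) * c)) ≤ 2 * Real.exp (Real.pi * (A * c) ^ 2) *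
        Real.exp (-Real.pi * (-((k + a) * c)) ^ 2) := by
      refine one_sub_E_le_of_neg_le ?_
      rw [neg_le_neg_iff]
      exact mul_le_mul_of_nonneg_right (by linarith) hc
    rw [E_neg, neg_sq] at h4
    rw [E_neg] at h3
    rw [abs_of_neg (by linarith)]
    linarith

open Complex in
/-- The Gaussian weight turns the exponentials of `R` into conjugates of theta terms. -/
theorem gaussian_mul_exp {m : ℕ} (hm : 0 < m) (u : ℂ) (τ : ℍ) (k : ℤ) :
    (Real.exp (-Real.pi * (((k : ℝ) + 2 * m * u.im / τ.im) * Real.sqrt (τ.im / m)) ^ 2) : ℂ) *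
      Complex.exp (-(Real.pi * Complex.I * k ^ 2 * τ / (2 * m)) - 2 * Real.pi * Complex.I * k * u) =
    (Real.exp (-(4 * Real.pi * m * u.im ^ 2 / τ.im)) : ℂ) *
      (starRingEnd ℂ) (thetaTerm m u τ k) := by
  have hy := τ.im_pos
  have hm' : (0 : ℝ) < m := by exact_mod_cast hm
  rw [mul_pow, Real.sq_sqrt (by positivity), thetaTerm, ← Complex.exp_conj, Complex.ofReal_exp,
    Complex.ofReal_exp, ← Complex.exp_add, ← Complex.exp_add]
  congr 1
  have hmc : (m : ℂ) ≠ 0 := by exact_mod_cast hm.ne'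
  have hyc : (τ.im : ℂ) ≠ 0 := by exact_mod_cast hy.ne'
  have hτ : (τ : ℂ) = τ.re + τ.im * I := (Complex.re_add_im _).symm
  have hu : u = u.re + u.im * I := (Complex.re_add_im _).symm
  simp only [map_add, map_mul, map_div₀, map_pow, conj_I, conj_ofReal, map_ofNat, map_natCast,
    map_intCast]
  rw [hτ]
  generalize τ.im = y at *
  generalize τ.re = x at *
  rw [hu]
  simp only [map_add, map_mul, conj_I, conj_ofReal, add_im, ofReal_im, mul_im, ofReal_re, I_re,
    I_im, mul_zero, mul_one, zero_add, add_zero]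
  push_cast
  field_simp
  ring_nf
  simp only [I_sq]
  ring

theorem norm_gaussian_mul_exp_le {m : ℕ} (hm : 0 < m) (u : ℂ) (τ : ℍ) (k : ℤ) :
    Real.exp (-Real.pi * (((k : ℝ) + 2 * m * u.im / τ.im) * Real.sqrt (τ.im / m)) ^ 2) *
      ‖Complex.exp (-(Real.pi * Complex.I * k ^ 2 * τ / (2 * m)) -
        2 * Real.pi * Complex.I * k * u)‖ ≤ ‖thetaTerm m u τ k‖ := by
  have hy := τ.im_pos
  have hpi := Real.pi_pos
  have h := congrArg norm (gaussian_mul_exp hm u τ k)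
  rw [norm_mul, norm_mul, Complex.norm_real, Complex.norm_real, Real.norm_of_nonneg
    (Real.exp_pos _).le, Real.norm_of_nonneg (Real.exp_pos _).le, RCLike.norm_conj] at h
  rw [h]
  refine mul_le_of_le_one_left (norm_nonneg _) (Real.exp_le_one_iff.mpr ?_)
  rw [neg_nonpos]
  positivity

/-- The exponentials in `R` grow like a Gaussian, but `sign - E` decays like its square; what
remains has the size of a theta term. -/
theorem exists_bound_RTerm {m : ℕ} (hm : 0 < m) (τ : ℍ) (S : ℝ) :
    ∃ C : ℝ, 0 ≤ C ∧ ∀ u : ℂ, |u.im| ≤ S → ∀ k : ℤ, ‖RTerm m u τ k‖ ≤ C * ‖thetaTerm m u τ k‖ := by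
  have hy := τ.im_pos
  refine ⟨2 * Real.exp (Real.pi * ((2 * m * S / τ.im) * Real.sqrt (τ.im / m)) ^ 2),
    by positivity, fun u hu k => ?_⟩
  have ha : |2 * m * u.im / τ.im| ≤ 2 * m * S / τ.im := by
    rw [abs_div, abs_mul, abs_of_pos hy, abs_of_nonneg (by positivity : (0 : ℝ) ≤ 2 * m)]
    gcongr
  have h1 := abs_sign_sub_E_le (Real.sqrt_nonneg (τ.im / m)) ha k
  unfold RTerm
  rw [norm_mul, Complex.norm_real, Real.norm_eq_abs]
  refine (mul_le_mul_of_nonneg_right h1 (norm_nonneg _)).trans ?_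
  rw [mul_assoc]
  exact mul_le_mul_of_nonneg_left (norm_gaussian_mul_exp_le hm u τ k) (by positivity)

theorem summable_RTerm {m : ℕ} (hm : 0 < m) (u : ℂ) (τ : ℍ) : Summable (RTerm m u τ) := by
  obtain ⟨C, -, hC⟩ := exists_bound_RTerm hm τ |u.im|
  exact Summable.of_norm_bounded ((summable_thetaTerm hm u τ).norm.mul_left C) (hC u le_rfl)

/-! ### Residue classes modulo `2m` and the elliptic transformation laws -/

/-- The residue class of `l` modulo `2m`, parametrized by `ℤ`. -/
def residueEquiv {m : ℕ} (hm : 0 < m) (l : ℤ) : ℤ ≃ {k : ℤ // k ≡ l [ZMOD (2 * m : ℤ)]} where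
  toFun j := ⟨l + 2 * m * j, by simp [Int.ModEq]⟩
  invFun k := (k - l) / (2 * m)
  left_inv j := by
    have : (2 * m : ℤ) ≠ 0 := by positivity
    simp [this]
  right_inv k := by
    ext
    obtain ⟨k, hk⟩ := k
    simp [Int.mul_ediv_cancel' hk.symm.dvd]

theorem tsum_residue {m : ℕ} (hm : 0 < m) (l : ℤ) (g : ℤ → ℂ) :
    ∑' k : {k : ℤ // k ≡ l [ZMOD (2 * m : ℤ)]}, g k = ∑' j : ℤ, g (l + 2 * m * j) :=
  ((residueEquiv hm l).tsum_eq fun k : {k : ℤ // k ≡ l [ZMOD (2 * m : ℤ)]} => g k).symm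

theorem injective_residue {m : ℕ} (hm : 0 < m) (l : ℤ) :
    Function.Injective fun j : ℤ => l + 2 * m * j := fun _ _ h =>
  (residueEquiv hm l).injective (Subtype.ext h)

theorem thetaML_eq {m : ℕ} (hm : 0 < m) (l : ℤ) (z : ℂ) (τ : ℍ) :
    thetaML m l z τ = ∑' j : ℤ, thetaTerm m z τ (l + 2 * m * j) := tsum_residue hm l _

theorem RML_eq {m : ℕ} (hm : 0 < m) (l : ℤ) (z : ℂ) (τ : ℍ) :
    RML m l z τ = ∑' j : ℤ, RTerm m z τ (l + 2 * m * j) := tsum_residue hm l _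

theorem exp_eq_of_int (n : ℤ) {x y : ℂ} (h : x = y + n * (2 * Real.pi * Complex.I)) :
    Complex.exp x = Complex.exp y :=
  Complex.exp_eq_exp_iff_exists_int.mpr ⟨n, h⟩

theorem thetaML_add {m : ℕ} (hm : 0 < m) (l : ℤ) (z : ℂ) (τ : ℍ) (k n : ℤ) :
    thetaML m l (z + k * (τ : ℂ) + n) τ =
      Complex.exp (-(2 * Real.pi * Complex.I * m * (k ^ 2 * (τ : ℂ) + 2 * k * z))) *
        thetaML m l z τ := by
  have hmc : (m : ℂ) ≠ 0 := by exact_mod_cast hm.ne'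
  rw [thetaML_eq hm, thetaML_eq hm, ← tsum_mul_left, ← (Equiv.addRight k).tsum_eq fun j : ℤ =>
    Complex.exp (-(2 * Real.pi * Complex.I * m * (k ^ 2 * (τ : ℂ) + 2 * k * z))) *
      thetaTerm m z τ (l + 2 * m * j)]
  refine tsum_congr fun j => ?_
  unfold thetaTerm
  rw [← Complex.exp_add]
  apply exp_eq_of_int ((l + 2 * m * j) * n)
  simp only [Equiv.coe_addRight]
  push_cast
  field_simp
  ring

/-- The translation only shifts the summation index. The matching is term by term, so it persists at
the poles, where the singular term is `0` on both sides. -/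
theorem f_add_z {m : ℕ} (u z : ℂ) (τ : ℍ) (k n : ℤ) :
    f m u (z + k * (τ : ℂ) + n) τ =
      Complex.exp (-(2 * Real.pi * Complex.I * m * (k ^ 2 * (τ : ℂ) + 2 * k * z))) *
        f m u z τ := by
  unfold f
  rw [← tsum_mul_left, ← (Equiv.addRight k).tsum_eq fun j : ℤ =>
    Complex.exp (-(2 * Real.pi * Complex.I * m * (k ^ 2 * (τ : ℂ) + 2 * k * z))) *
      fTerm m u z τ j]
  refine tsum_congr fun j => ?_
  unfold fTerm
  rw [mul_div_assoc', ← Complex.exp_add]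
  congr 1
  · apply exp_eq_of_int (2 * m * j * n)
    simp only [Equiv.coe_addRight]
    push_cast
    ring
  · congr 1
    apply exp_eq_of_int n
    simp only [Equiv.coe_addRight]
    push_cast
    ring

theorem fTilde_add_z {m : ℕ} (hm : 0 < m) (u z : ℂ) (τ : ℍ) (k n : ℤ) :
    fTilde m u (z + k * (τ : ℂ) + n) τ =
      Complex.exp (-(2 * Real.pi * Complex.I * m * (k ^ 2 * (τ : ℂ) + 2 * k * z))) *
        fTilde m u z τ := by
  unfold fTilde
  simp_rw [thetaML_add hm, f_add_z, mul_sub, Finset.mul_sum]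
  congr 1
  refine Finset.sum_congr rfl fun l _ => ?_
  ring

theorem fTilde_add_int_u (m : ℕ) (u z : ℂ) (τ : ℍ) (n : ℤ) :
    fTilde m (u + n) z τ = fTilde m u z τ := by
  have h1 : f m (u + n) z τ = f m u z τ := by
    refine tsum_congr fun k => ?_
    unfold fTerm
    congr 2
    apply exp_eq_of_int (-n)
    push_cast
    ring
  have h2 : ∀ l, RML m l (u + n) τ = RML m l u τ := fun l => by
    refine tsum_congr fun k => ?_
    unfold RTerm
    have h : Complex.exp (-(Real.pi * Complex.I * (k : ℤ) ^ 2 * τ / (2 * m)) -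
        2 * Real.pi * Complex.I * (k : ℤ) * (u + n)) =
        Complex.exp (-(Real.pi * Complex.I * (k : ℤ) ^ 2 * τ / (2 * m)) -
        2 * Real.pi * Complex.I * (k : ℤ) * u) := by
      apply exp_eq_of_int (-(k * n))
      push_cast
      ring
    rw [h]
    simp
  unfold fTilde
  simp_rw [h1, h2]

/-- The correction terms by which `f` and `R` fail to be elliptic in `u`. -/
noncomputable def corr (m : ℕ) (u : ℂ) (τ : ℍ) (k : ℤ) : ℂ :=
  Complex.exp (-(Real.pi * Complex.I * k ^ 2 * τ / (2 * m)) - 2 * Real.pi * Complex.I * k * u)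

/-- Raising the index along with `u` keeps the denominator `1 - w` and multiplies the numerator by
`w ^ (2m)` and the automorphy factor. Then `w ^ (2m) / (1 - w)` is `1 / (1 - w)` minus the geometric
sum, and each power `w ^ j` factors into a `corr` term and a theta term. -/
theorem fTerm_add_tau_u {m : ℕ} (hm : 0 < m) {u z : ℂ} {τ : ℍ} (h : z ∉ latticeCoset u τ) (k : ℤ) :
    fTerm m (u + τ) z τ (k + 1) =
      Complex.exp (2 * Real.pi * Complex.I * m * (τ + 2 * u)) * (fTerm m u z τ k -
        ∑ j ∈ Finset.range (2 * m), corr m u τ j * thetaTerm m z τ (j + 2 * m * k)) := by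
  have hmc : (m : ℂ) ≠ 0 := by exact_mod_cast hm.ne'
  have hw := one_sub_exp_ne_zero h k
  set w := Complex.exp (2 * Real.pi * Complex.I * k * τ + 2 * Real.pi * Complex.I * (z - u)) with hwdef
  set N := Complex.exp (2 * Real.pi * Complex.I * m * k ^ 2 * τ + 4 * Real.pi * Complex.I * m * k * z)
    with hN
  have h1 : ∀ j : ℕ, corr m u τ j * thetaTerm m z τ (j + 2 * m * k) = N * w ^ j := fun j => by
    unfold corr thetaTerm
    rw [hwdef, hN, ← Complex.exp_nat_mul, ← Complex.exp_add, ← Complex.exp_add]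
    congr 1
    push_cast
    field_simp
    ring
  have h2 : fTerm m (u + τ) z τ (k + 1) =
      Complex.exp (2 * Real.pi * Complex.I * m * (τ + 2 * u)) * (N * w ^ (2 * m)) / (1 - w) := by
    unfold fTerm
    rw [hwdef, hN, ← Complex.exp_nat_mul, ← Complex.exp_add, ← Complex.exp_add]
    congr 2
    · push_cast
      ring
    · push_cast
      ring_nf
  have hw1 : w ≠ 1 := fun h0 => hw (by rw [h0, sub_self])
  have h3 : w - 1 ≠ 0 := sub_ne_zero.mpr hw1
  simp_rw [h1, h2, ← Finset.mul_sum]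
  rw [geom_sum_eq hw1, show fTerm m u z τ k = N / (1 - w) from rfl, ← neg_sub w 1]
  field_simp
  ring

theorem f_add_tau_u {m : ℕ} (hm : 0 < m) {u z : ℂ} {τ : ℍ} (h : z ∉ latticeCoset u τ) :
    f m (u + τ) z τ = Complex.exp (2 * Real.pi * Complex.I * m * (τ + 2 * u)) *
      (f m u z τ - ∑ j ∈ Finset.range (2 * m), corr m u τ j * thetaML m j z τ) := by
  have hs : ∀ j : ℕ, Summable fun k : ℤ => thetaTerm m z τ (j + 2 * m * k) := fun j =>
    (summable_thetaTerm hm z τ).comp_injective (injective_residue hm j)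
  unfold f
  rw [← (Equiv.addRight (1 : ℤ)).tsum_eq]
  simp_rw [Equiv.coe_addRight, fTerm_add_tau_u hm h, thetaML_eq hm]
  rw [tsum_mul_left, (summable_fTerm hm u z τ).tsum_sub
    (summable_sum fun j _ => (hs j).mul_left _), Summable.tsum_finsetSum
    fun j _ => (hs j).mul_left _]
  simp_rw [tsum_mul_left]

theorem RTerm_eq_corr (m : ℕ) (u : ℂ) (τ : ℍ) (k : ℤ) :
    RTerm m u τ k = ((Real.sign ((k : ℝ) + 1 / 2) -
      E (((k : ℝ) + 2 * m * u.im / τ.im) * Real.sqrt (τ.im / m)) : ℝ) : ℂ) * corr m u τ k := rfl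

/-- Shifting the index by `2m` compensates the shift of `u` in `E` and in the exponential, so only
the signs can differ. For the representative `0 ≤ l < 2m` they differ exactly at `j = 0`, where the
index passes from `l - 2m < 0` to `l ≥ 0`. -/
theorem RML_add_tau {m : ℕ} (hm : 0 < m) (u : ℂ) (τ : ℍ) {l : ℕ} (hl : l < 2 * m) :
    RML m l (u + τ) τ = Complex.exp (2 * Real.pi * Complex.I * m * (τ + 2 * u)) *
      (RML m l u τ - 2 * corr m u τ l) := by
  have hmc : (m : ℂ) ≠ 0 := by exact_mod_cast hm.ne'
  have hy : τ.im ≠ 0 := τ.im_pos.ne'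
  rw [RML_eq hm, RML_eq hm, ← (Equiv.addRight (-1 : ℤ)).tsum_eq]
  have key : ∀ j : ℤ, RTerm m (u + τ) τ (l + 2 * m * (j + -1)) =
      Complex.exp (2 * Real.pi * Complex.I * m * (τ + 2 * u)) * (RTerm m u τ (l + 2 * m * j) -
        if j = 0 then 2 * corr m u τ l else 0) := by
    intro j
    have h1 : corr m (u + τ) τ (l + 2 * m * (j + -1)) =
        Complex.exp (2 * Real.pi * Complex.I * m * (τ + 2 * u)) * corr m u τ (l + 2 * m * j) := by
      unfold corr
      rw [← Complex.exp_add]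
      congr 1
      push_cast
      field_simp
      ring
    have h2 : (((l + 2 * m * (j + -1) : ℤ) : ℝ) + 2 * m * (u + τ).im / τ.im) =
        ((l + 2 * m * j : ℤ) : ℝ) + 2 * m * u.im / τ.im := by
      have : (u + (τ : ℂ)).im = u.im + τ.im := by simp
      rw [this]
      push_cast
      field_simp
      ring
    rw [RTerm_eq_corr, RTerm_eq_corr, h1, h2, sign_int_add_half, sign_int_add_half]
    rcases lt_trichotomy j 0 with hj | rfl | hj
    · rw [if_neg (by nlinarith), if_neg (by nlinarith), if_neg hj.ne]
      ring
    · rw [if_neg (by lia), if_pos (by lia), if_pos rfl]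
      push_cast
      simp only [mul_zero, add_zero]
      ring
    · rw [if_pos (by nlinarith), if_pos (by nlinarith), if_neg hj.ne']
      ring
  have hs : Summable fun j : ℤ => RTerm m u τ (l + 2 * m * j) :=
    (summable_RTerm hm u τ).comp_injective (injective_residue hm l)
  simp_rw [Equiv.coe_addRight, key]
  rw [tsum_mul_left, hs.tsum_sub (summable_of_ne_finset_zero (s := {0}) (by simp +contextual)),
    tsum_ite_eq]

theorem fTilde_add_tau_u {m : ℕ} (hm : 0 < m) {u z : ℂ} {τ : ℍ} (h : z ∉ latticeCoset u τ) :
    fTilde m (u + τ) z τ = Complex.exp (2 * Real.pi * Complex.I * m * (τ + 2 * u)) *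
      fTilde m u z τ := by
  unfold fTilde
  have h1 : ∑ l ∈ Finset.range (2 * m), RML m l (u + τ) τ * thetaML m l z τ =
      ∑ l ∈ Finset.range (2 * m), Complex.exp (2 * Real.pi * Complex.I * m * (τ + 2 * u)) *
        (RML m l u τ * thetaML m l z τ - 2 * (corr m u τ l * thetaML m l z τ)) :=
    Finset.sum_congr rfl fun l hl => by
      rw [RML_add_tau hm u τ (Finset.mem_range.mp hl)]
      ring
  rw [f_add_tau_u hm h, h1, ← Finset.mul_sum, Finset.sum_sub_distrib, ← Finset.mul_sum]
  ring

theorem mem_latticeCoset_add_iff {u z : ℂ} {τ : ℍ} (k n : ℤ) :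
    z ∈ latticeCoset (u + k * (τ : ℂ) + n) τ ↔ z ∈ latticeCoset u τ := by
  constructor
  · rintro ⟨a, b, rfl⟩
    exact ⟨k + a, n + b, by push_cast; ring⟩
  · rintro ⟨a, b, rfl⟩
    exact ⟨a - k, b - n, by push_cast; ring⟩

theorem fTilde_add_u {m : ℕ} (hm : 0 < m) {u z : ℂ} {τ : ℍ} (h : z ∉ latticeCoset u τ) (k n : ℤ) :
    fTilde m (u + k * (τ : ℂ) + n) z τ =
      Complex.exp (2 * Real.pi * Complex.I * m * (k ^ 2 * (τ : ℂ) + 2 * k * u)) *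
        fTilde m u z τ := by
  have hk : ∀ k : ℤ, z ∉ latticeCoset (u + k * (τ : ℂ)) τ := fun k hz =>
    h ((mem_latticeCoset_add_iff k 0).mp (by simpa using hz))
  rw [fTilde_add_int_u]
  induction k using Int.induction_on with
  | zero => simp
  | succ i ih =>
    have := fTilde_add_tau_u hm (hk i)
    rw [ih, ← mul_assoc, ← Complex.exp_add] at this
    convert this using 2
    · push_cast; ring
    · congr 1; push_cast; ring
  | pred i ih =>
    -- For a step downwards, the law is applied at the lower point and then solved for its value
    -- there.
    have := fTilde_add_tau_u hm (hk (-i - 1))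
    rw [show u + ((-i - 1 : ℤ) : ℂ) * (τ : ℂ) + τ = u + ((-i : ℤ) : ℂ) * τ by push_cast; ring, ih]
      at this
    have h2 := congrArg (fun x => Complex.exp (-(2 * Real.pi * Complex.I * m *
      (τ + 2 * (u + ((-i - 1 : ℤ) : ℂ) * (τ : ℂ))))) * x) this
    simp only [← mul_assoc, ← Complex.exp_add] at h2
    rw [neg_add_cancel, Complex.exp_zero, one_mul] at h2
    rw [← h2]
    congr 2
    push_cast
    ring

/-! ### Analyticity and poles of `f` and `fTilde` -/

theorem analyticAt_fTerm {m : ℕ} {τ : ℍ} {U Z : ℂ → ℂ} (hU : Differentiable ℂ U)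
    (hZ : Differentiable ℂ Z) {w₀ : ℂ} {k : ℤ}
    (h : 1 - Complex.exp (2 * Real.pi * Complex.I * k * τ +
      2 * Real.pi * Complex.I * (Z w₀ - U w₀)) ≠ 0) :
    AnalyticAt ℂ (fun w => fTerm m (U w) (Z w) τ k) w₀ := by
  unfold fTerm
  refine AnalyticAt.div ?_ ?_ h
  · exact Differentiable.analyticAt (by fun_prop) w₀
  · exact Differentiable.analyticAt (by fun_prop) w₀

/-- A second vanishing denominator would make a nonzero integral multiple of `τ` an integer. Hence
each lattice point is a pole of exactly one term. -/
theorem one_sub_exp_ne_zero_of_ne {τ : ℍ} {u z : ℂ} {k n : ℤ} (h : z - u = k * τ + n) {j : ℤ}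
    (hj : j ≠ -k) : 1 - Complex.exp (2 * Real.pi * Complex.I * j * τ +
      2 * Real.pi * Complex.I * (z - u)) ≠ 0 := by
  intro h0
  rw [h, sub_eq_zero, eq_comm, Complex.exp_eq_one_iff] at h0
  obtain ⟨p, hp⟩ := h0
  have h2 : ((j + k : ℤ) : ℂ) * τ = ((p - n : ℤ) : ℂ) := by
    push_cast
    exact mul_left_cancel₀ Complex.two_pi_I_ne_zero (by linear_combination hp)
  have h3 := congrArg Complex.im h2
  rw [← Complex.ofReal_intCast, Complex.im_ofReal_mul, Complex.intCast_im] at h3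
  rcases mul_eq_zero.mp h3 with h4 | h4
  · have : j + k = 0 := by exact_mod_cast h4
    lia
  · exact τ.im_pos.ne' h4

/-- Finitely many terms are analytic at the point itself; the rest have a common summable bound on a
neighbourhood. Letting both arguments be functions `U`, `Z` serves variation in `z` and in `u`
alike. -/
theorem analyticAt_tsum_fTerm_ne {m : ℕ} (hm : 0 < m) {τ : ℍ} {U Z : ℂ → ℂ}
    (hU : Differentiable ℂ U) (hZ : Differentiable ℂ Z) {w₀ : ℂ} {k₀ : ℤ}
    (h : ∀ k ≠ k₀, 1 - Complex.exp (2 * Real.pi * Complex.I * k * τ +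
      2 * Real.pi * Complex.I * (Z w₀ - U w₀)) ≠ 0) :
    AnalyticAt ℂ (fun w => ∑' k, if k = k₀ then 0 else fTerm m (U w) (Z w) τ k) w₀ := by
  set M := max |(U w₀).im| |(Z w₀).im| + 1 with hM
  obtain ⟨s, b, hb, hs⟩ := exists_bound_fTerm hm τ M
  set O : Set ℂ := {w | |(U w).im| < M ∧ |(Z w).im| < M} with hO
  have hOo : IsOpen O := by
    have h1 := (Complex.continuous_im.comp hU.continuous).abs
    have h2 := (Complex.continuous_im.comp hZ.continuous).abs
    exact (isOpen_lt h1 continuous_const).inter (isOpen_lt h2 continuous_const)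
  have hw₀ : w₀ ∈ O := ⟨(le_max_left _ _).trans_lt (lt_add_one _),
    (le_max_right _ _).trans_lt (lt_add_one _)⟩
  have hsplit : (fun w => ∑' k, if k = k₀ then 0 else fTerm m (U w) (Z w) τ k) =
      fun w => ∑ k ∈ s, (if k = k₀ then 0 else fTerm m (U w) (Z w) τ k) +
        ∑' k, if k ∈ s then 0 else if k = k₀ then 0 else fTerm m (U w) (Z w) τ k := by
    funext w
    have h1 := summable_fTerm hm (U w) (Z w) τ
    have h2 : Summable fun k : ℤ => if k ∈ s then 0 else if k = k₀ then 0 else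
        fTerm m (U w) (Z w) τ k := by
      refine Summable.of_norm_bounded h1.norm fun k => ?_
      split_ifs <;> simp
    have h3 : Summable fun k : ℤ => if k ∈ s then if k = k₀ then 0 else
        fTerm m (U w) (Z w) τ k else 0 := by
      refine Summable.of_norm_bounded h1.norm fun k => ?_
      split_ifs <;> simp
    rw [← tsum_eq_sum (L := SummationFilter.unconditional ℤ) (s := s) (f := fun k : ℤ =>
      if k ∈ s then if k = k₀ then 0 else fTerm m (U w) (Z w) τ k else 0)
      (fun k hk => if_neg hk) |>.trans (Finset.sum_congr rfl fun k hk => if_pos hk), ← h3.tsum_add h2]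
    refine tsum_congr fun k => ?_
    split_ifs <;> simp
  rw [hsplit]
  refine AnalyticAt.add ?_ ?_
  · refine Finset.analyticAt_fun_sum _ fun k _ => ?_
    split_ifs with hk
    · exact analyticAt_const
    · exact analyticAt_fTerm hU hZ (h k hk)
  · refine DifferentiableOn.analyticAt (s := O) ?_ (hOo.mem_nhds hw₀)
    refine Complex.differentiableOn_tsum_of_summable_norm (hb.abs) (fun k w hw => ?_) hOo
      fun k w hw => ?_
    · split_ifs with hk hk'
      · exact differentiableWithinAt_const _
      · exact differentiableWithinAt_const _
      · exact (analyticAt_fTerm hU hZ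
          (hs (U w) (Z w) hw.1.le hw.2.le k hk).1).differentiableAt.differentiableWithinAt
    · split_ifs with hk hk'
      · simp
      · simp
      · exact (hs (U w) (Z w) hw.1.le hw.2.le k hk).2.trans (le_abs_self _)

theorem f_eq_add_tsum {m : ℕ} (hm : 0 < m) (u z : ℂ) (τ : ℍ) (k₀ : ℤ) :
    f m u z τ = fTerm m u z τ k₀ + ∑' k, if k = k₀ then 0 else fTerm m u z τ k :=
  (summable_fTerm hm u z τ).tsum_eq_add_tsum_ite k₀

theorem analyticAt_f {m : ℕ} (hm : 0 < m) {τ : ℍ} {U Z : ℂ → ℂ} (hU : Differentiable ℂ U)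
    (hZ : Differentiable ℂ Z) {w₀ : ℂ} (h : Z w₀ ∉ latticeCoset (U w₀) τ) :
    AnalyticAt ℂ (fun w => f m (U w) (Z w) τ) w₀ := by
  simp_rw [fun w => f_eq_add_tsum hm (U w) (Z w) τ 0]
  exact (analyticAt_fTerm hU hZ (one_sub_exp_ne_zero h 0)).add
    (analyticAt_tsum_fTerm_ne hm hU hZ fun k _ => one_sub_exp_ne_zero h k)

theorem tendsto_div_one_sub_exp :
    Filter.Tendsto (fun w : ℂ => w / (1 - Complex.exp (2 * Real.pi * Complex.I * w))) (𝓝[≠] 0)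
      (𝓝 (-1 / (2 * Real.pi * Complex.I))) := by
  have h : HasDerivAt (fun w : ℂ => Complex.exp (2 * Real.pi * Complex.I * w))
      (2 * Real.pi * Complex.I) 0 := by
    have h1 : HasDerivAt (fun w : ℂ => 2 * Real.pi * Complex.I * w) (2 * Real.pi * Complex.I) 0 := by
      simpa using (hasDerivAt_id (0 : ℂ)).const_mul (2 * Real.pi * Complex.I)
    simpa using h1.cexp
  have h2 := (hasDerivAt_iff_tendsto_slope.mp h).inv₀ Complex.two_pi_I_ne_zero
  have h3 := h2.neg
  rw [← one_div, ← neg_div] at h3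
  refine h3.congr fun w => ?_
  simp only [slope_def_field, mul_zero, Complex.exp_zero, sub_zero]
  rw [inv_div, ← div_neg, neg_sub]

/-- Only the term with index `-k` is singular at `w₀`; the others contribute an analytic function,
killed by `w - w₀`. The slope `ε` is `1` when `z` moves and `-1` when `u` moves. -/
theorem tendsto_sub_mul_f {m : ℕ} (hm : 0 < m) {τ : ℍ} {U Z : ℂ → ℂ} (hU : Differentiable ℂ U)
    (hZ : Differentiable ℂ Z) {w₀ ε : ℂ} (hε : ε ≠ 0) {k n : ℤ}
    (h : ∀ w, Z w - U w = ε * (w - w₀) + k * τ + n) :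
    Filter.Tendsto (fun w => (w - w₀) * f m (U w) (Z w) τ) (𝓝[≠] w₀)
      (𝓝 (Complex.exp (2 * Real.pi * Complex.I * m * k ^ 2 * τ -
        4 * Real.pi * Complex.I * m * k * Z w₀) * (ε⁻¹ * (-1 / (2 * Real.pi * Complex.I))))) := by
  have hden : ∀ j ≠ -k, 1 - Complex.exp (2 * Real.pi * Complex.I * j * τ +
      2 * Real.pi * Complex.I * (Z w₀ - U w₀)) ≠ 0 := by
    intro j hj
    exact one_sub_exp_ne_zero_of_ne (k := k) (n := n) (by rw [h]; ring) hj
  have hlim0 : Filter.Tendsto (fun w => w - w₀) (𝓝[≠] w₀) (𝓝 0) := by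
    have : Continuous fun w : ℂ => w - w₀ := by fun_prop
    simpa using (this.tendsto w₀).mono_left nhdsWithin_le_nhds
  have h1 : Filter.Tendsto (fun w => (w - w₀) *
      ∑' j, if j = -k then 0 else fTerm m (U w) (Z w) τ j) (𝓝[≠] w₀) (𝓝 0) := by
    have := hlim0.mul ((analyticAt_tsum_fTerm_ne hm hU hZ hden).continuousAt.tendsto.mono_left
      nhdsWithin_le_nhds)
    simpa using this
  have h2 : Filter.Tendsto (fun w => (w - w₀) * fTerm m (U w) (Z w) τ (-k)) (𝓝[≠] w₀)
      (𝓝 (Complex.exp (2 * Real.pi * Complex.I * m * k ^ 2 * τ -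
        4 * Real.pi * Complex.I * m * k * Z w₀) * (ε⁻¹ * (-1 / (2 * Real.pi * Complex.I))))) := by
    have ha : Filter.Tendsto (fun w => Complex.exp (2 * Real.pi * Complex.I * m * k ^ 2 * τ -
        4 * Real.pi * Complex.I * m * k * Z w)) (𝓝[≠] w₀) (𝓝 (Complex.exp (2 * Real.pi *
        Complex.I * m * k ^ 2 * τ - 4 * Real.pi * Complex.I * m * k * Z w₀))) := by
      have hc : Continuous fun w => Complex.exp (2 * Real.pi * Complex.I * m * k ^ 2 * τ -
        4 * Real.pi * Complex.I * m * k * Z w) := by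
        have := hZ.continuous
        fun_prop
      exact (hc.tendsto w₀).mono_left nhdsWithin_le_nhds
    have hb : Filter.Tendsto (fun w => ε * (w - w₀)) (𝓝[≠] w₀) (𝓝[≠] 0) := by
      refine tendsto_nhdsWithin_iff.mpr ⟨by simpa using hlim0.const_mul ε, ?_⟩
      filter_upwards [self_mem_nhdsWithin] with w hw
      exact mul_ne_zero hε (sub_ne_zero.mpr hw)
    have hc := ha.mul ((tendsto_div_one_sub_exp.comp hb).const_mul ε⁻¹)
    refine hc.congr fun w => ?_
    have hexp : Complex.exp (2 * Real.pi * Complex.I * (-k : ℤ) * τ +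
        2 * Real.pi * Complex.I * (Z w - U w)) =
        Complex.exp (2 * Real.pi * Complex.I * (ε * (w - w₀))) := by
      rw [h]
      apply exp_eq_of_int n
      push_cast
      ring
    unfold fTerm
    rw [hexp, Function.comp_apply]
    have hnum : Complex.exp (2 * Real.pi * Complex.I * m * (-k : ℤ) ^ 2 * τ +
        4 * Real.pi * Complex.I * m * (-k : ℤ) * Z w) = Complex.exp (2 * Real.pi * Complex.I *
        m * k ^ 2 * τ - 4 * Real.pi * Complex.I * m * k * Z w) := by
      congr 1
      push_cast
      ring
    rw [hnum]
    field_simp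
  have h3 := h2.add h1
  rw [add_zero] at h3
  refine h3.congr fun w => ?_
  rw [f_eq_add_tsum hm (U w) (Z w) τ (-k)]
  ring

theorem thetaML_eq_jacobiTheta₂ {m : ℕ} (hm : 0 < m) (l : ℤ) (z : ℂ) (τ : ℍ) :
    thetaML m l z τ = Complex.exp (Real.pi * Complex.I * l ^ 2 * τ / (2 * m) +
      2 * Real.pi * Complex.I * l * z) * jacobiTheta₂ (l * τ + 2 * m * z) (2 * m * τ) := by
  have hmc : (m : ℂ) ≠ 0 := by exact_mod_cast hm.ne'
  rw [thetaML_eq hm, jacobiTheta₂, ← tsum_mul_left]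
  refine tsum_congr fun j => ?_
  unfold thetaTerm jacobiTheta₂_term
  rw [← Complex.exp_add]
  congr 1
  push_cast
  field_simp
  ring

theorem differentiable_thetaML {m : ℕ} (hm : 0 < m) (l : ℤ) (τ : ℍ) :
    Differentiable ℂ fun z => thetaML m l z τ := by
  have him : 0 < (2 * m * (τ : ℂ)).im := by
    rw [im_two_mul_nat_mul]
    have hm' : (0 : ℝ) < m := by exact_mod_cast hm
    exact mul_pos (mul_pos two_pos hm') τ.im_pos
  simp_rw [thetaML_eq_jacobiTheta₂ hm]
  refine Differentiable.mul (by fun_prop) fun z => ?_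
  have h1 : DifferentiableAt ℂ (fun z : ℂ => l * (τ : ℂ) + 2 * m * z) z := by fun_prop
  exact DifferentiableAt.comp z (differentiableAt_jacobiTheta₂_fst (l * τ + 2 * m * z) him) h1

theorem analyticAt_correction_z {m : ℕ} (hm : 0 < m) (u : ℂ) (τ : ℍ) (z : ℂ) : AnalyticAt ℂ
    (fun z => (1 / 2) * ∑ l ∈ Finset.range (2 * m), RML m l u τ * thetaML m l z τ) z := by
  have h : ∀ l : ℤ, Differentiable ℂ fun z => thetaML m l z τ :=
    fun l => differentiable_thetaML hm l τ
  exact Differentiable.analyticAt (by fun_prop) z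

theorem analyticAt_fTilde_z {m : ℕ} (hm : 0 < m) {u z : ℂ} {τ : ℍ} (h : z ∉ latticeCoset u τ) :
    AnalyticAt ℂ (fun z => fTilde m u z τ) z :=
  (analyticAt_f hm (differentiable_const u) differentiable_id h).sub
    (analyticAt_correction_z hm u τ z)

theorem tendsto_sub_mul_fTilde_z {m : ℕ} (hm : 0 < m) (u : ℂ) (τ : ℍ) (k n : ℤ) :
    Filter.Tendsto (fun z => (z - (u + k * (τ : ℂ) + n)) * fTilde m u z τ)
      (𝓝[≠] (u + k * (τ : ℂ) + n)) (𝓝 (Complex.exp (2 * Real.pi * Complex.I * m * k ^ 2 * τ -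
        4 * Real.pi * Complex.I * m * k * (u + k * (τ : ℂ) + n)) *
          (-1 / (2 * Real.pi * Complex.I)))) := by
  have h1 := tendsto_sub_mul_f hm (τ := τ) (differentiable_const u) differentiable_id
    (w₀ := u + k * (τ : ℂ) + n) (ε := 1) one_ne_zero (k := k) (n := n) (fun w => by simp; ring)
  have h2 : ContinuousAt (fun z => (z - (u + k * (τ : ℂ) + n)) *
      ((1 / 2) * ∑ l ∈ Finset.range (2 * m), RML m l u τ * thetaML m l z τ))
      (u + k * (τ : ℂ) + n) :=
    ContinuousAt.mul (by fun_prop) (analyticAt_correction_z hm u τ _).continuousAt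
  have h3 := h1.sub (h2.tendsto.mono_left nhdsWithin_le_nhds)
  simp only [sub_self, zero_mul, sub_zero, inv_one, one_mul, id_eq] at h3
  refine h3.congr fun z => ?_
  unfold fTilde
  ring

theorem meromorphicAt_fTilde_z {m : ℕ} (hm : 0 < m) (u : ℂ) (τ : ℍ) (k n : ℤ) :
    MeromorphicAt (fun z => fTilde m u z τ) (u + k * (τ : ℂ) + n) := by
  set z₀ := u + k * (τ : ℂ) + n with hz₀
  have h1 : AnalyticAt ℂ (fun z => ∑' j, if j = -k then 0 else fTerm m u z τ j) z₀ := by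
    refine analyticAt_tsum_fTerm_ne hm (differentiable_const u) differentiable_id ?_
    intro j hj
    exact one_sub_exp_ne_zero_of_ne (k := k) (n := n) (by simp only [id, hz₀]; ring) hj
  have h2 : MeromorphicAt (fun z => fTerm m u z τ (-k)) z₀ := by
    unfold fTerm
    exact (Differentiable.analyticAt (by fun_prop) z₀).meromorphicAt.div
      (Differentiable.analyticAt (by fun_prop) z₀).meromorphicAt
  have h3 := (h2.add h1.meromorphicAt).sub (analyticAt_correction_z hm u τ z₀).meromorphicAt
  refine h3.congr (Filter.Eventually.of_forall fun z => ?_)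
  simp only [Pi.sub_apply, Pi.add_apply, ← f_eq_add_tsum hm u z τ (-k)]
  rfl

/-- Multiplication by the linear factor gives a finite nonzero limit, that is, order `0`; the linear
factor itself accounts for `1`. -/
theorem meromorphicOrderAt_fTilde_z {m : ℕ} (hm : 0 < m) (u : ℂ) (τ : ℍ) (k n : ℤ) :
    meromorphicOrderAt (fun z => fTilde m u z τ) (u + k * (τ : ℂ) + n) = (-1 : ℤ) := by
  set z₀ := u + k * (τ : ℂ) + n with hz₀
  have hmer := meromorphicAt_fTilde_z hm u τ k n
  have hlin : MeromorphicAt (fun z : ℂ => z - z₀) z₀ := by fun_prop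
  have h0 := (tendsto_ne_zero_iff_meromorphicOrderAt_eq_zero (hlin.mul hmer)).mp
    ⟨_, mul_ne_zero (Complex.exp_ne_zero _) (div_ne_zero (by simp) Complex.two_pi_I_ne_zero),
      tendsto_sub_mul_fTilde_z hm u τ k n⟩
  have h1 : meromorphicOrderAt (fun z : ℂ => z - z₀) z₀ = 1 := meromorphicOrderAt_id_sub_const
  rw [meromorphicOrderAt_mul hlin hmer, h1] at h0
  generalize meromorphicOrderAt (fun z => fTilde m u z τ) z₀ = o at h0
  induction o using WithTop.recTopCoe with
  | top => simp at h0
  | coe a =>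
    have : (1 + a : ℤ) = 0 := by exact_mod_cast h0
    have : a = -1 := by lia
    rw [this]

/-! ### The antiholomorphic derivative of `R` -/

/-- The conjugate term in the derivative of `R`, up to a constant factor. -/
noncomputable def dbarTerm (m : ℕ) (u : ℂ) (τ : ℍ) (k : ℤ) : ℂ :=
  (Real.exp (-(4 * Real.pi * m * u.im ^ 2 / τ.im)) : ℂ) * (starRingEnd ℂ) (thetaTerm m u τ k)

/-- The constant factor in the antiholomorphic derivative of `R`. -/
noncomputable def dbarConst (m : ℕ) (τ : ℍ) : ℂ :=
  -(2 * Complex.I * (m / τ.im) * Real.sqrt (τ.im / m))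

/-- `E` is the only factor that is not holomorphic in `u`. Its derivative is a Gaussian, which
`gaussian_mul_exp` merges with the exponential into a conjugate theta term; writing `Im h` through
`h` and its conjugate separates the two parts. -/
theorem hasFDerivAt_RTerm {m : ℕ} (hm : 0 < m) (u : ℂ) (τ : ℍ) (k : ℤ) :
    HasFDerivAt (𝕜 := ℝ) (fun u => RTerm m u τ k)
      ((-(dbarConst m τ * dbarTerm m u τ k) - 2 * Real.pi * Complex.I * k * RTerm m u τ k) •
          ContinuousLinearMap.id ℝ ℂ +
        (dbarConst m τ * dbarTerm m u τ k) • (Complex.conjCLE : ℂ →L[ℝ] ℂ)) u := by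
  set c := Real.sqrt (τ.im / m) with hc
  have h1 : HasFDerivAt (𝕜 := ℝ) (fun u : ℂ => ((k : ℝ) + 2 * m * u.im / τ.im) * c)
      ((2 * m / τ.im * c) • Complex.imCLM) u := by
    have h := (Complex.imCLM.hasFDerivAt (x := u)).const_mul (2 * m / τ.im * c)
    have h' := h.const_add (k * c)
    refine h'.congr_of_eventuallyEq (Filter.Eventually.of_forall fun w => ?_)
    simp only [Complex.imCLM_apply]
    ring
  have h2 := (((hasDerivAt_E _).comp_hasFDerivAt u h1).const_sub
    (Real.sign ((k : ℝ) + 1 / 2)))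
  have h3 := (Complex.ofRealCLM.hasFDerivAt (x := Real.sign ((k : ℝ) + 1 / 2) -
    E (((k : ℝ) + 2 * m * u.im / τ.im) * c))).comp u h2
  have h4 : HasDerivAt (fun u => corr m u τ k) (corr m u τ k * (-(2 * Real.pi * Complex.I * k))) u := by
    have h : HasDerivAt (fun u : ℂ => -(Real.pi * Complex.I * k ^ 2 * τ / (2 * m)) -
        2 * Real.pi * Complex.I * k * u) (-(2 * Real.pi * Complex.I * k)) u := by
      simpa using ((hasDerivAt_id u).const_mul (2 * Real.pi * Complex.I * k)).const_sub
        (-(Real.pi * Complex.I * k ^ 2 * τ / (2 * m)))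
    exact h.cexp
  have h5 := h4.hasFDerivAt.restrictScalars ℝ
  have h6 := h3.mul h5
  have hg : (Real.exp (-Real.pi * (((k : ℝ) + 2 * m * u.im / τ.im) * c) ^ 2) : ℂ) *
      corr m u τ k = dbarTerm m u τ k := gaussian_mul_exp hm u τ k
  refine h6.congr_fderiv ?_
  refine ContinuousLinearMap.ext fun h => ?_
  have him : (h.im : ℂ) = -(Complex.I * (h - (starRingEnd ℂ) h)) / 2 := by
    rw [Complex.sub_conj]
    push_cast
    linear_combination (h.im : ℂ) * Complex.I_sq
  simp only [RTerm_eq_corr, dbarConst, ← hc, ← hg]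
  simp
  linear_combination (-(corr m u τ k * (2 * Complex.exp (-(Real.pi * (((k : ℂ) +
    2 * m * u.im / τ.im) * c) ^ 2)) * (2 * m / τ.im * c)))) * him

theorem norm_dbarTerm_le (m : ℕ) (u : ℂ) (τ : ℍ) (k : ℤ) :
    ‖dbarTerm m u τ k‖ ≤ ‖thetaTerm m u τ k‖ := by
  have hy := τ.im_pos
  have hpi := Real.pi_pos
  unfold dbarTerm
  rw [norm_mul, Complex.norm_real, Real.norm_of_nonneg (Real.exp_pos _).le, RCLike.norm_conj]
  refine mul_le_of_le_one_left (norm_nonneg _) (Real.exp_le_one_iff.mpr ?_)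
  rw [neg_nonpos]
  positivity

theorem norm_smul_id_add_smul_conj_le (a b : ℂ) :
    ‖a • ContinuousLinearMap.id ℝ ℂ + b • (Complex.conjCLE : ℂ →L[ℝ] ℂ)‖ ≤ ‖a‖ + ‖b‖ := by
  refine (norm_add_le _ _).trans ?_
  rw [norm_smul, norm_smul, Complex.conjCLE_norm, ContinuousLinearMap.norm_id, mul_one, mul_one]

/-- `R` is real differentiable, and its antiholomorphic derivative is a conjugate theta function. -/
theorem exists_hasFDerivAt_RML {m : ℕ} (hm : 0 < m) (l : ℤ) (u : ℂ) (τ : ℍ) :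
    ∃ a : ℂ, HasFDerivAt (𝕜 := ℝ) (fun u => RML m l u τ)
      (a • ContinuousLinearMap.id ℝ ℂ +
        (dbarConst m τ * (Real.exp (-(4 * Real.pi * m * u.im ^ 2 / τ.im)) *
          (starRingEnd ℂ) (thetaML m l u τ))) • (Complex.conjCLE : ℂ →L[ℝ] ℂ)) u := by
  have hpi := Real.pi_pos
  -- This bounds the imaginary part on the unit ball around `u`, where the differentiation under the
  -- sum takes place.
  set S := |u.im| + 1 with hS
  obtain ⟨C, hC0, hC⟩ := exists_bound_RTerm hm τ S
  set β : ℤ → ℝ := fun k => Real.exp (-Real.pi * (τ.im / (2 * m) * k ^ 2 - 2 * S * |k|)) with hβ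
  have hβ0 : Summable β := by simpa [hβ] using summable_gaussian_bound hm τ S 0
  have hβ1 : Summable fun k : ℤ => |(k : ℝ)| * β k := by
    simpa [hβ] using summable_gaussian_bound hm τ S 1
  set A : ℂ → ℤ → ℂ := fun w k => -(dbarConst m τ * dbarTerm m w τ k) -
    2 * Real.pi * Complex.I * k * RTerm m w τ k with hA
  set B : ℂ → ℤ → ℂ := fun w k => dbarConst m τ * dbarTerm m w τ k with hB
  have him : ∀ w ∈ Metric.ball u 1, |w.im| ≤ S := fun w hw => by
    have h1 : |(w - u).im| ≤ ‖w - u‖ := Complex.abs_im_le_norm _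
    rw [Metric.mem_ball, dist_eq_norm] at hw
    have h2 := abs_add_le u.im (w - u).im
    rw [Complex.sub_im, add_sub_cancel] at h2
    rw [Complex.sub_im] at h1
    linarith
  have hBle : ∀ w ∈ Metric.ball u 1, ∀ k, ‖B w k‖ ≤ ‖dbarConst m τ‖ * β k := fun w hw k => by
    rw [hB, norm_mul]
    exact mul_le_mul_of_nonneg_left ((norm_dbarTerm_le m w τ k).trans
      (norm_thetaTerm_le hm τ (him w hw) k)) (norm_nonneg _)
  have hAle : ∀ w ∈ Metric.ball u 1, ∀ k, ‖A w k‖ ≤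
      ‖dbarConst m τ‖ * β k + 2 * Real.pi * C * (|(k : ℝ)| * β k) := fun w hw k => by
    have h1 := hBle w hw k
    have h2 := (hC w (him w hw) k).trans
      (mul_le_mul_of_nonneg_left (norm_thetaTerm_le hm τ (him w hw) k) hC0)
    have h3 : ‖2 * Real.pi * Complex.I * k * RTerm m w τ k‖ ≤
        2 * Real.pi * |(k : ℝ)| * (C * β k) := by
      rw [norm_mul]
      refine mul_le_mul (le_of_eq ?_) h2 (norm_nonneg _) (by positivity)
      simp [abs_of_pos hpi]
    refine (norm_sub_le _ _).trans ?_
    rw [norm_neg]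
    linarith
  have hu : u ∈ Metric.ball u 1 := Metric.mem_ball_self one_pos
  have hAs : Summable fun k : {k : ℤ // k ≡ l [ZMOD (2 * m : ℤ)]} => A u k :=
    (Summable.of_norm_bounded ((hβ0.mul_left _).add (hβ1.mul_left _)) (hAle u hu)).subtype _
  have hBs : Summable fun k : {k : ℤ // k ≡ l [ZMOD (2 * m : ℤ)]} => B u k :=
    (Summable.of_norm_bounded (hβ0.mul_left _) (hBle u hu)).subtype _
  have key := hasFDerivAt_tsum_of_isPreconnected (𝕜 := ℝ) (s := Metric.ball u 1) (x₀ := u) (x := u)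
    (f := fun (k : {k : ℤ // k ≡ l [ZMOD (2 * m : ℤ)]}) w => RTerm m w τ k)
    (f' := fun k w => A w k • ContinuousLinearMap.id ℝ ℂ +
      B w k • (Complex.conjCLE : ℂ →L[ℝ] ℂ))
    (u := fun k : {k : ℤ // k ≡ l [ZMOD (2 * m : ℤ)]} => ‖dbarConst m τ‖ * β k + 2 * Real.pi * C * (|((k : ℤ) : ℝ)| * β k) +
      ‖dbarConst m τ‖ * β k)
    ((((hβ0.mul_left _).add (hβ1.mul_left _)).add (hβ0.mul_left _)).subtype _)
    Metric.isOpen_ball (convex_ball u 1).isPreconnected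
    (fun k w _ => hasFDerivAt_RTerm hm w τ k)
    (fun k w hw => (norm_smul_id_add_smul_conj_le _ _).trans
      (add_le_add (hAle w hw k) (hBle w hw k))) hu ((summable_RTerm hm u τ).subtype _) hu
  -- Only the conjugate part has to be identified; the holomorphic coefficient stays an unevaluated
  -- series.
  rw [(hAs.smul_const _).tsum_add (hBs.smul_const _), hAs.tsum_smul_const, hBs.tsum_smul_const]
    at key
  have hBt : ∑' k : {k : ℤ // k ≡ l [ZMOD (2 * m : ℤ)]}, B u k =
      dbarConst m τ * (Real.exp (-(4 * Real.pi * m * u.im ^ 2 / τ.im)) *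
        (starRingEnd ℂ) (thetaML m l u τ)) := by
    unfold thetaML
    simp only [hB, dbarTerm]
    rw [tsum_mul_left, tsum_mul_left, Complex.conj_tsum]
  rw [hBt] at key
  exact ⟨_, key⟩

/-! ### The theta kernel and its inversion formula -/

theorem sum_tsum_residue {m : ℕ} (hm : 0 < m) {g : ℤ → ℂ} (hg : Summable g) :
    ∑ j ∈ Finset.range (2 * m), ∑' k : {k : ℤ // k ≡ j [ZMOD (2 * m : ℤ)]}, g k = ∑' k, g k := by
  have h1 : ∀ j : ℕ, ∑' k : {k : ℤ // k ≡ j [ZMOD (2 * m : ℤ)]}, g k =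
      ∑' k, {k : ℤ | k ≡ j [ZMOD (2 * m : ℤ)]}.indicator g k := fun j =>
    tsum_subtype {k : ℤ | k ≡ j [ZMOD (2 * m : ℤ)]} g
  have hm2 : (0 : ℤ) < 2 * m := by positivity
  simp_rw [h1]
  rw [← Summable.tsum_finsetSum fun j _ => hg.indicator _]
  refine tsum_congr fun k => ?_
  have h0 := Int.emod_nonneg k hm2.ne'
  have hlt := Int.emod_lt_of_pos k hm2
  rw [Finset.sum_eq_single (k % (2 * m)).toNat]
  · rw [Set.indicator_of_mem]
    rw [Set.mem_ofPred_eq, Int.toNat_of_nonneg h0]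
    exact (Int.mod_modEq k _).symm
  · intro j hj hne
    rw [Set.indicator_of_notMem]
    intro hk
    rw [Finset.mem_range] at hj
    have h2 : k % (2 * m) = j % (2 * m) := hk
    rw [Int.emod_eq_of_lt (a := (j : ℤ)) (by lia) (by lia)] at h2
    lia
  · intro hk
    rw [Finset.mem_range] at hk
    lia

theorem sum_tsum_residue_mul {m : ℕ} (hm : 0 < m) {g h : ℤ → ℂ}
    (hg : Summable fun k => g k * h k) (hh : ∀ k l : ℤ, k ≡ l [ZMOD (2 * m : ℤ)] → h k = h l) :
    ∑ j ∈ Finset.range (2 * m), (∑' k : {k : ℤ // k ≡ j [ZMOD (2 * m : ℤ)]}, g k) * h j =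
      ∑' k, g k * h k := by
  rw [← sum_tsum_residue hm hg]
  refine Finset.sum_congr rfl fun j _ => ?_
  rw [← tsum_mul_right]
  exact tsum_congr fun k => by rw [hh k j k.2]

/-- The character `k ↦ exp (-2πi l k / 2m)` of `ℤ / 2m`. -/
noncomputable def chr (m : ℕ) (l k : ℤ) : ℂ :=
  Complex.exp (-(2 * Real.pi * Complex.I * (l * k) / (2 * m)))

/-- The shift by `l / (2m)` multiplies the `k`-th term by a phase that depends only on `k` modulo
`2m`. The argument appears with `-z` because the functional equation produces it so; evenness makes
this harmless. -/
theorem jacobiTheta₂_eq_sum_thetaML {m : ℕ} (hm : 0 < m) (l : ℤ) (z : ℂ) (τ : ℍ) :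
    jacobiTheta₂ (l / (2 * m) - z) (τ / (2 * m)) =
      ∑ j ∈ Finset.range (2 * m), thetaML m j z τ * chr m l j := by
  have hmc : (m : ℂ) ≠ 0 := by exact_mod_cast hm.ne'
  have hterm : ∀ k : ℤ, jacobiTheta₂_term k (z - l / (2 * m)) (τ / (2 * m)) =
      thetaTerm m z τ k * chr m l k := fun k => by
    unfold jacobiTheta₂_term thetaTerm chr
    rw [← Complex.exp_add]
    congr 1
    field_simp
    ring
  have hs : Summable fun k => thetaTerm m z τ k * chr m l k := by
    refine ((summable_jacobiTheta₂_term_iff (z - l / (2 * m)) (τ / (2 * m))).mpr ?_).congr hterm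
    rw [im_div_two_mul_nat]
    have := τ.im_pos
    exact div_pos this (by positivity)
  unfold thetaML
  rw [sum_tsum_residue_mul hm hs, ← neg_sub, jacobiTheta₂_neg_left, jacobiTheta₂]
  · exact tsum_congr hterm
  · intro k j hkj
    obtain ⟨p, hp⟩ := hkj.symm.dvd
    apply exp_eq_of_int (-(l * p))
    have : (k : ℂ) = j + 2 * m * p := by
      have : k = j + 2 * m * p := by lia
      rw [this]
      push_cast
      ring
    rw [this]
    push_cast
    field_simp
    ring

/-- Each summand is a power of `ρ`, and `ρ ^ (2m) = 1`; for `i ≠ j` the bound `|i - j| < 2m`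
excludes `ρ = 1`. -/
theorem sum_conj_chr_mul_chr {m : ℕ} (hm : 0 < m) {i j : ℕ} (hi : i < 2 * m) (hj : j < 2 * m) :
    ∑ l ∈ Finset.range (2 * m), (starRingEnd ℂ) (chr m l i) * chr m l j =
      if i = j then 2 * (m : ℂ) else 0 := by
  have hmc : (m : ℂ) ≠ 0 := by exact_mod_cast hm.ne'
  set ρ := Complex.exp (2 * Real.pi * Complex.I * ((i - j) / (2 * m))) with hρ
  have h1 : ∀ l : ℕ, (starRingEnd ℂ) (chr m l i) * chr m l j = ρ ^ l := fun l => by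
    unfold chr
    rw [← Complex.exp_conj, ← Complex.exp_add, hρ, ← Complex.exp_nat_mul]
    congr 1
    simp only [map_neg, map_mul, map_div₀, Complex.conj_I, Complex.conj_ofReal, map_ofNat,
      map_natCast, map_intCast]
    push_cast
    field_simp
    ring
  simp_rw [h1]
  split_ifs with h
  · have : ρ = 1 := by rw [hρ, h]; simp
    simp [this]
  · have hne : ρ ≠ 1 := by
      intro h0
      rw [hρ, Complex.exp_eq_one_iff] at h0
      obtain ⟨n, hn⟩ := h0
      have h2 : ((i : ℂ) - j) / (2 * m) = n :=
        mul_left_cancel₀ Complex.two_pi_I_ne_zero (by linear_combination hn)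
      rw [div_eq_iff (mul_ne_zero two_ne_zero hmc)] at h2
      have h3 : (i : ℤ) - j = n * (2 * m) := by exact_mod_cast h2
      have h4 : n = 0 := by
        by_contra hn0
        rcases lt_or_gt_of_ne hn0 with h5 | h5 <;> nlinarith
      rw [h4] at h3
      lia
    rw [geom_sum_eq hne]
    have : ρ ^ (2 * m) = 1 := by
      rw [hρ, ← Complex.exp_nat_mul, Complex.exp_eq_one_iff]
      refine ⟨i - j, ?_⟩
      push_cast
      field_simp
    rw [this]
    simp

/-- The reproducing kernel of the space spanned by the theta functions `θ_{m,l}`. -/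
noncomputable def thetaKernel (m : ℕ) (u z : ℂ) (τ : ℍ) : ℂ :=
  ∑ l ∈ Finset.range (2 * m), (starRingEnd ℂ) (thetaML m l u τ) * thetaML m l z τ

/-- The finite Fourier transform modulo `2m` is unitary up to the factor `2m`, so it preserves the
Hermitian sum defining the kernel. -/
theorem sum_conj_jacobiTheta₂ {m : ℕ} (hm : 0 < m) (u z : ℂ) (τ : ℍ) :
    ∑ l ∈ Finset.range (2 * m), (starRingEnd ℂ) (jacobiTheta₂ (l / (2 * m) - u) (τ / (2 * m))) *
      jacobiTheta₂ (l / (2 * m) - z) (τ / (2 * m)) = 2 * m * thetaKernel m u z τ := by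
  have h := fun (l : ℕ) (z : ℂ) => jacobiTheta₂_eq_sum_thetaML hm l z τ
  simp only [Int.cast_natCast] at h
  simp_rw [h, map_sum, Finset.sum_mul_sum]
  rw [Finset.sum_comm]
  unfold thetaKernel
  rw [Finset.mul_sum]
  refine Finset.sum_congr rfl fun i hi => ?_
  rw [Finset.sum_comm]
  have h2 : ∀ j ∈ Finset.range (2 * m), ∑ l ∈ Finset.range (2 * m),
      (starRingEnd ℂ) (thetaML m i u τ * chr m l i) * (thetaML m j z τ * chr m l j) =
      if i = j then 2 * m * ((starRingEnd ℂ) (thetaML m i u τ) * thetaML m i z τ) else 0 := by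
    intro j hj
    have h3 := sum_conj_chr_mul_chr hm (Finset.mem_range.mp hi) (Finset.mem_range.mp hj)
    have h4 : ∀ l : ℕ, (starRingEnd ℂ) (thetaML m i u τ * chr m l i) *
        (thetaML m j z τ * chr m l j) = (starRingEnd ℂ) (thetaML m i u τ) * thetaML m j z τ *
          ((starRingEnd ℂ) (chr m l i) * chr m l j) := fun l => by
      rw [map_mul]
      ring
    simp_rw [h4, ← Finset.mul_sum, h3]
    split_ifs with hij
    · rw [hij]
      ring
    · ring
  rw [Finset.sum_congr rfl h2, Finset.sum_ite_eq, if_pos hi]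

theorem thetaML_inversion {m : ℕ} (hm : 0 < m) (l : ℤ) (z : ℂ) {τ σ : ℍ} (hσ : (σ : ℂ) = -1 / τ) :
    thetaML m l (z / τ) σ = 1 / (-Complex.I * (2 * m * σ)) ^ (1 / 2 : ℂ) *
      Complex.exp (2 * Real.pi * Complex.I * m * z ^ 2 / τ) *
        jacobiTheta₂ (l / (2 * m) - z) (τ / (2 * m)) := by
  have hmc : (m : ℂ) ≠ 0 := by exact_mod_cast hm.ne'
  have hτ : (τ : ℂ) ≠ 0 := τ.ne_zero
  rw [thetaML_eq_jacobiTheta₂ hm, jacobiTheta₂_functional_equation]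
  have h1 : (l * (σ : ℂ) + 2 * m * (z / τ)) / (2 * m * σ) = l / (2 * m) - z := by
    rw [hσ]
    field_simp
    ring
  have h2 : -1 / (2 * m * (σ : ℂ)) = τ / (2 * m) := by
    rw [hσ]
    field_simp
  have h3 : Complex.exp (Real.pi * Complex.I * l ^ 2 * σ / (2 * m) +
      2 * Real.pi * Complex.I * l * (z / τ)) *
      Complex.exp (-Real.pi * Complex.I * (l * (σ : ℂ) + 2 * m * (z / τ)) ^ 2 / (2 * m * σ)) =
      Complex.exp (2 * Real.pi * Complex.I * m * z ^ 2 / τ) := by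
    rw [← Complex.exp_add, hσ]
    congr 1
    field_simp
    ring
  rw [h1, h2, ← h3]
  ring

/-- The square root in the functional equation enters only through its modulus, so no choice of
branch survives, and the factor `2m` from the Fourier transform cancels. -/
theorem thetaKernel_inversion {m : ℕ} (hm : 0 < m) (u z : ℂ) {τ σ : ℍ} (hσ : (σ : ℂ) = -1 / τ) :
    thetaKernel m (u / τ) (z / τ) σ = (‖(τ : ℂ)‖ : ℂ) *
      (starRingEnd ℂ) (Complex.exp (2 * Real.pi * Complex.I * m * u ^ 2 / τ)) *
        Complex.exp (2 * Real.pi * Complex.I * m * z ^ 2 / τ) * thetaKernel m u z τ := by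
  have hmc : (m : ℂ) ≠ 0 := by exact_mod_cast hm.ne'
  have hτ : (τ : ℂ) ≠ 0 := τ.ne_zero
  set p := 1 / (-Complex.I * (2 * m * σ)) ^ (1 / 2 : ℂ) with hp
  have hpp : (starRingEnd ℂ) p * p = (‖(τ : ℂ)‖ : ℂ) / (2 * m) := by
    have h1 : p ^ 2 = 1 / (-Complex.I * (2 * m * σ)) := by
      rw [hp, div_pow, ← Complex.cpow_nat_mul]
      norm_num
    have h2 : ‖p‖ ^ 2 = ‖(τ : ℂ)‖ / (2 * m) := by
      rw [← norm_pow, h1, hσ]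
      simp
      field_simp
    rw [Complex.conj_mul', ← Complex.ofReal_pow, h2]
    push_cast
    rfl
  have h3 : thetaKernel m (u / τ) (z / τ) σ = ∑ l ∈ Finset.range (2 * m),
      ((starRingEnd ℂ) p * p) *
      ((starRingEnd ℂ) (Complex.exp (2 * Real.pi * Complex.I * m * u ^ 2 / τ)) *
        Complex.exp (2 * Real.pi * Complex.I * m * z ^ 2 / τ)) *
      ((starRingEnd ℂ) (jacobiTheta₂ (l / (2 * m) - u) (τ / (2 * m))) *
      jacobiTheta₂ (l / (2 * m) - z) (τ / (2 * m))) := by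
    refine Finset.sum_congr rfl fun l _ => ?_
    rw [thetaML_inversion hm l u hσ, thetaML_inversion hm l z hσ, map_mul, map_mul,
      Int.cast_natCast]
    ring
  rw [h3, ← Finset.mul_sum, sum_conj_jacobiTheta₂ hm, hpp]
  field_simp

/-! ### Entire functions with negative index -/

/-- Translation into the rectangle `[0,1] × [0, Im τ]` costs a bounded factor, because the index is
negative; so `F` is bounded and, by Liouville, constant. The factor for `u = 0`, `k = 1` has modulus
less than `1`, so the constant is zero. -/
theorem eq_zero_of_negative_index {m : ℕ} (hm : 0 < m) {τ : ℍ} {F : ℂ → ℂ}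
    (hF : Differentiable ℂ F) (h : ∀ (u : ℂ) (k n : ℤ), F (u + k * (τ : ℂ) + n) =
      Complex.exp (2 * Real.pi * Complex.I * m * (k ^ 2 * (τ : ℂ) + 2 * k * u)) * F u) (u : ℂ) :
    F u = 0 := by
  have hy : 0 < τ.im := τ.im_pos
  have hpi := Real.pi_pos
  have hm' : (0 : ℝ) < m := by exact_mod_cast hm
  have hnorm : ∀ (u : ℂ) (k : ℤ), ‖Complex.exp (2 * Real.pi * Complex.I * m *
      (k ^ 2 * (τ : ℂ) + 2 * k * u))‖ =
      Real.exp (-(2 * Real.pi * m * (k ^ 2 * τ.im + 2 * k * u.im))) := fun u k => by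
    rw [Complex.norm_exp]
    congr 1
    have : 2 * Real.pi * Complex.I * m * (k ^ 2 * (τ : ℂ) + 2 * k * u) =
        ((2 * Real.pi * m : ℝ) : ℂ) * (Complex.I * (((k ^ 2 : ℝ) : ℂ) * τ +
          ((2 * k : ℝ) : ℂ) * u)) := by
      push_cast
      ring
    rw [this, Complex.re_ofReal_mul, Complex.I_mul_re, Complex.add_im, Complex.im_ofReal_mul,
      Complex.im_ofReal_mul, UpperHalfPlane.coe_im]
    ring
  obtain ⟨C, hC⟩ := ((isCompact_Icc (a := (0 : ℝ)) (b := 1)).reProdIm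
    (isCompact_Icc (a := (0 : ℝ)) (b := τ.im))).exists_bound_of_continuousOn
      hF.continuous.continuousOn
  have hbound : ∀ u, ‖F u‖ ≤ Real.exp (2 * Real.pi * m * τ.im) * C := by
    intro u
    set k := ⌊u.im / τ.im⌋ with hk
    set n := ⌊(u - k * (τ : ℂ)).re⌋ with hn
    set u₀ := u - k * (τ : ℂ) - n with hu₀
    have him : u₀.im = u.im - k * τ.im := by
      rw [hu₀]
      simp
    have hre : u₀.re = (u - k * (τ : ℂ)).re - n := by
      rw [hu₀]
      simp
    have h1 := Int.floor_le (u.im / τ.im)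
    have h2 := Int.lt_floor_add_one (u.im / τ.im)
    rw [← hk, le_div_iff₀ hy] at h1
    rw [← hk, div_lt_iff₀ hy] at h2
    have h3 := Int.floor_le (u - k * (τ : ℂ)).re
    have h4 := Int.lt_floor_add_one (u - k * (τ : ℂ)).re
    rw [← hn] at h3 h4
    have hi0 : 0 ≤ u₀.im := by linarith
    have hi1 : u₀.im ≤ τ.im := by linarith
    have hmem : u₀ ∈ Set.Icc (0 : ℝ) 1 ×ℂ Set.Icc (0 : ℝ) τ.im :=
      ⟨⟨by linarith, by linarith⟩, hi0, hi1⟩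
    have hu : u = u₀ + k * (τ : ℂ) + n := by
      rw [hu₀]
      ring
    have hC0 := hC u₀ hmem
    rw [hu, h, norm_mul, hnorm]
    refine mul_le_mul (Real.exp_le_exp.mpr ?_) hC0 (norm_nonneg _) (Real.exp_pos _).le
    -- For `k < 0` the left-over is at least `((k + 1)² - 1) Im τ`, since `Im u₀ ≤ Im τ`.
    have h5 : -τ.im ≤ k ^ 2 * τ.im + 2 * k * u₀.im := by
      rcases le_or_gt 0 k with hk0 | hk0
      · have : (0 : ℝ) ≤ k := by exact_mod_cast hk0
        have := mul_nonneg this hi0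
        nlinarith [mul_nonneg (sq_nonneg (k : ℝ)) hy.le]
      · have : (k : ℝ) < 0 := by exact_mod_cast hk0
        nlinarith [mul_nonneg (sq_nonneg ((k : ℝ) + 1)) hy.le]
    have h6 : 0 < 2 * Real.pi * m := by positivity
    nlinarith
  have hconst : ∀ w, F w = F 0 := fun w => hF.apply_eq_apply_of_bounded
    (isBounded_iff_forall_norm_le.mpr ⟨_, by rintro _ ⟨v, rfl⟩; exact hbound v⟩) w 0
  have h1 := h 0 1 0
  rw [hconst] at h1
  by_contra hne
  rw [hconst] at hne
  have h2 : Complex.exp (2 * Real.pi * Complex.I * m *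
      (((1 : ℤ) : ℂ) ^ 2 * (τ : ℂ) + 2 * ((1 : ℤ) : ℂ) * 0)) = 1 :=
    mul_right_cancel₀ hne (by rw [← h1, one_mul])
  have h3 := congrArg norm h2
  rw [hnorm, norm_one, Real.exp_eq_one_iff] at h3
  have : 0 < 2 * Real.pi * m * τ.im := by positivity
  rw [Complex.zero_im, Int.cast_one] at h3
  linarith

/-! ### Removing the singularities on a lattice coset -/

theorem mem_latticeCoset_comm {u z : ℂ} {τ : ℍ} : z ∈ latticeCoset u τ ↔ u ∈ latticeCoset z τ := by
  constructor <;> rintro ⟨k, n, rfl⟩ <;> exact ⟨-k, -n, by push_cast; ring⟩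

theorem latticeCoset_countable (u : ℂ) (τ : ℍ) : (latticeCoset u τ).Countable := by
  refine (Set.countable_range fun p : ℤ × ℤ => u + p.1 * (τ : ℂ) + p.2).mono ?_
  rintro _ ⟨k, n, rfl⟩
  exact ⟨(k, n), rfl⟩

theorem latticeCoset_pairwise (u : ℂ) (τ : ℍ) :
    (latticeCoset u τ).Pairwise fun p q => min 1 τ.im ≤ dist p q := by
  rintro _ ⟨k, n, rfl⟩ _ ⟨k', n', rfl⟩ hne
  have hy := τ.im_pos
  by_contra! hlt
  rw [dist_eq_norm] at hlt
  set d := u + k * (τ : ℂ) + n - (u + k' * (τ : ℂ) + n') with hd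
  have him : d.im = ((k - k' : ℤ) : ℝ) * τ.im := by
    rw [hd]
    simp
    ring
  have h1 : |((k - k' : ℤ) : ℝ)| * τ.im < 1 * τ.im := by
    rw [← abs_of_pos hy, ← abs_mul, abs_of_pos hy, ← him, one_mul]
    exact (Complex.abs_im_le_norm d).trans_lt (hlt.trans_le (min_le_right _ _))
  have h2 : k = k' := by
    have h3 := lt_of_mul_lt_mul_right h1 hy.le
    have : |k - k'| < 1 := by exact_mod_cast h3
    rw [Int.abs_lt_one_iff] at this
    lia
  have hre : d.re = ((n - n' : ℤ) : ℝ) := by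
    rw [hd, h2]
    simp
  have h4 : |((n - n' : ℤ) : ℝ)| < 1 := by
    rw [← hre]
    exact (Complex.abs_re_le_norm d).trans_lt (hlt.trans_le (min_le_left _ _))
  have h5 : n = n' := by
    have : |n - n'| < 1 := by exact_mod_cast h4
    rw [Int.abs_lt_one_iff] at this
    lia
  exact hne (by rw [h2, h5])

-- Riemann's theorem on removable singularities, applied at all lattice points at once; their
-- uniform separation isolates each of them and makes the coset closed.
open Classical in
theorem exists_entire_extension {z : ℂ} {τ : ℍ} {D : ℂ → ℂ}
    (hd : ∀ u ∉ latticeCoset z τ, DifferentiableAt ℂ D u)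
    (hl : ∀ p ∈ latticeCoset z τ,
      Filter.Tendsto (fun u => (u - p) * D u) (𝓝[≠] p) (𝓝 0)) :
    ∃ F : ℂ → ℂ, Differentiable ℂ F ∧ ∀ u ∉ latticeCoset z τ, F u = D u := by
  have hε : 0 < min 1 τ.im := lt_min one_pos τ.im_pos
  have hclosed : IsClosed (latticeCoset z τ) :=
    Metric.isClosed_of_pairwise_le_dist hε (latticeCoset_pairwise z τ)
  refine ⟨fun u => if u ∈ latticeCoset z τ then (𝓝[≠] u).limUnder D else D u, fun p => ?_,
    fun u hu => if_neg hu⟩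
  by_cases hp : p ∈ latticeCoset z τ
  · have hball : Metric.ball p (min 1 τ.im) ∈ 𝓝 p := Metric.ball_mem_nhds p hε
    have hnot : ∀ w ∈ Metric.ball p (min 1 τ.im), w ≠ p → w ∉ latticeCoset z τ :=
      fun w hw hne hwL => (latticeCoset_pairwise z τ hwL hp hne).not_gt hw
    have h1 := Complex.differentiableOn_update_limUnder_of_isLittleO hball (f := D)
      (fun w hw => (hd w (hnot w hw.1 hw.2)).differentiableWithinAt) (by
        refine (Asymptotics.isLittleO_iff_tendsto' ?_).mpr ?_
        · filter_upwards [self_mem_nhdsWithin] with w hw h0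
          exact absurd (inv_eq_zero.mp h0) (sub_ne_zero.mpr hw)
        -- The removability criterion concerns `D w - D p`; the arbitrary value `D p` disappears
        -- after multiplication by `w - p`.
        · have hc : Filter.Tendsto (fun w => (w - p) * D p) (𝓝[≠] p) (𝓝 0) := by
            have : Continuous fun w : ℂ => (w - p) * D p := by fun_prop
            simpa using (this.tendsto p).mono_left nhdsWithin_le_nhds
          have := (hl p hp).sub hc
          rw [sub_zero] at this
          refine this.congr fun w => ?_
          rw [div_inv_eq_mul]
          ring)
    refine (h1.differentiableAt hball).congr_of_eventuallyEq ?_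
    filter_upwards [hball] with w hw
    by_cases hwp : w = p
    · subst hwp
      simp [hp]
    · rw [Function.update_of_ne hwp, if_neg (hnot w hw hwp)]
  · refine (hd p hp).congr_of_eventuallyEq ?_
    filter_upwards [hclosed.isOpen_compl.mem_nhds hp] with w hw
    exact if_neg hw

/-! ### Antiholomorphic derivatives -/

/-- `g` is real differentiable at `u` with antiholomorphic derivative `b`. -/
def HasDbar (g : ℂ → ℂ) (b u : ℂ) : Prop :=
  ∃ a : ℂ, HasFDerivAt (𝕜 := ℝ) g
    (a • ContinuousLinearMap.id ℝ ℂ + b • (Complex.conjCLE : ℂ →L[ℝ] ℂ)) u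

theorem HasDbar.continuousAt {g : ℂ → ℂ} {b u : ℂ} (h : HasDbar g b u) : ContinuousAt g u :=
  h.choose_spec.continuousAt

theorem _root_.DifferentiableAt.hasDbar {g : ℂ → ℂ} {u : ℂ} (h : DifferentiableAt ℂ g u) :
    HasDbar g 0 u := by
  refine ⟨deriv g u, (h.hasDerivAt.hasFDerivAt.restrictScalars ℝ).congr_fderiv ?_⟩
  refine ContinuousLinearMap.ext fun w => ?_
  simp [mul_comm]

/-- These are the Cauchy–Riemann equations: without conjugate part the real derivative is complex
linear. -/
theorem HasDbar.differentiableAt {g : ℂ → ℂ} {u : ℂ} (h : HasDbar g 0 u) :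
    DifferentiableAt ℂ g u := by
  obtain ⟨a, ha⟩ := h
  refine (hasFDerivAt_of_restrictScalars (𝕜 := ℝ) (f' := a • ContinuousLinearMap.id ℂ ℂ)
    ha ?_).differentiableAt
  refine ContinuousLinearMap.ext fun w => ?_
  simp

theorem HasDbar.sub {g h : ℂ → ℂ} {b c u : ℂ} (hg : HasDbar g b u) (hh : HasDbar h c u) :
    HasDbar (fun w => g w - h w) (b - c) u := by
  obtain ⟨a, ha⟩ := hg
  obtain ⟨a', ha'⟩ := hh
  refine ⟨a - a', (ha.sub ha').congr_fderiv ?_⟩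
  refine ContinuousLinearMap.ext fun w => ?_
  simp
  ring

theorem HasDbar.mul {g h : ℂ → ℂ} {b u : ℂ} (hh : DifferentiableAt ℂ h u) (hg : HasDbar g b u) :
    HasDbar (fun w => h w * g w) (h u * b) u := by
  obtain ⟨a, ha⟩ := hg
  obtain ⟨a', ha'⟩ := hh.hasDbar
  refine ⟨h u * a + g u * a', (ha'.mul ha).congr_fderiv ?_⟩
  refine ContinuousLinearMap.ext fun w => ?_
  simp
  ring

theorem HasDbar.sum {ι : Type*} {s : Finset ι} {g : ι → ℂ → ℂ} {b : ι → ℂ} {u : ℂ}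
    (h : ∀ i ∈ s, HasDbar (g i) (b i) u) :
    HasDbar (fun w => ∑ i ∈ s, g i w) (∑ i ∈ s, b i) u := by
  choose! a ha using h
  refine ⟨∑ i ∈ s, a i, (HasFDerivAt.fun_sum ha).congr_fderiv ?_⟩
  refine ContinuousLinearMap.ext fun w => ?_
  simp [Finset.sum_mul, Finset.sum_add_distrib]

theorem HasDbar.comp_div {g : ℂ → ℂ} {b u : ℂ} (c : ℂ) (h : HasDbar g b (u / c)) :
    HasDbar (fun w => g (w / c)) (b / (starRingEnd ℂ) c) u := by
  obtain ⟨a, ha⟩ := h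
  have h1 : HasFDerivAt (𝕜 := ℝ) (fun w : ℂ => w / c) (c⁻¹ • ContinuousLinearMap.id ℝ ℂ) u := by
    have h0 : HasDerivAt (fun w : ℂ => w / c) (1 / c) u := (hasDerivAt_id u).div_const c
    refine (h0.hasFDerivAt.restrictScalars ℝ).congr_fderiv ?_
    refine ContinuousLinearMap.ext fun w => ?_
    simp [mul_comm]
  refine ⟨a / c, (ha.comp u h1).congr_fderiv ?_⟩
  refine ContinuousLinearMap.ext fun w => ?_
  simp
  ring

/-! ### The transformation law under `τ ↦ -1/τ` -/

theorem hasDbar_fTilde_u {m : ℕ} (hm : 0 < m) {u z : ℂ} {τ : ℍ} (h : z ∉ latticeCoset u τ) :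
    HasDbar (fun u => fTilde m u z τ) (-((1 / 2) * (dbarConst m τ *
      (Real.exp (-(4 * Real.pi * m * u.im ^ 2 / τ.im)) * thetaKernel m u z τ)))) u := by
  have h1 : HasDbar (fun u => f m u z τ) 0 u :=
    (analyticAt_f hm differentiable_id (differentiable_const z) h).differentiableAt.hasDbar
  have h2 : HasDbar (fun u => ∑ l ∈ Finset.range (2 * m), thetaML m l z τ * RML m l u τ)
      (∑ l ∈ Finset.range (2 * m), thetaML m l z τ * (dbarConst m τ *
        (Real.exp (-(4 * Real.pi * m * u.im ^ 2 / τ.im)) *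
          (starRingEnd ℂ) (thetaML m l u τ)))) u :=
    HasDbar.sum fun l _ =>
      HasDbar.mul (differentiableAt_const _) (exists_hasFDerivAt_RML hm l u τ)
  have h3 := h1.sub (HasDbar.mul (differentiableAt_const (1 / 2 : ℂ)) h2)
  convert h3 using 1
  · funext w
    unfold fTilde
    congr 2
    exact Finset.sum_congr rfl fun l _ => mul_comm _ _
  · unfold thetaKernel
    rw [zero_sub]
    congr 2
    rw [Finset.mul_sum, Finset.mul_sum]
    refine Finset.sum_congr rfl fun l _ => ?_
    ring

theorem tendsto_sub_mul_fTilde_u {m : ℕ} (hm : 0 < m) (z : ℂ) (τ : ℍ) :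
    Filter.Tendsto (fun u => (u - z) * fTilde m u z τ) (𝓝[≠] z)
      (𝓝 (1 / (2 * Real.pi * Complex.I))) := by
  have h1 := tendsto_sub_mul_f hm (τ := τ) differentiable_id (differentiable_const z)
    (w₀ := z) (ε := -1) (by norm_num) (k := 0) (n := 0) (fun w => by simp)
  have h2 : ContinuousAt (fun u => (u - z) *
      ((1 / 2) * ∑ l ∈ Finset.range (2 * m), RML m l u τ * thetaML m l z τ)) z := by
    have : ∀ l : ℤ, ContinuousAt (fun u => RML m l u τ) z := fun l =>
      (exists_hasFDerivAt_RML hm l z τ).choose_spec.continuousAt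
    fun_prop
  have h3 := h1.sub (h2.tendsto.mono_left nhdsWithin_le_nhds)
  have h4 : Complex.exp (2 * Real.pi * Complex.I * m * ((0 : ℤ) : ℂ) ^ 2 * τ -
      4 * Real.pi * Complex.I * m * ((0 : ℤ) : ℂ) * z) *
      ((-1 : ℂ)⁻¹ * (-1 / (2 * Real.pi * Complex.I))) -
      (z - z) * ((1 / 2) * ∑ l ∈ Finset.range (2 * m), RML m l z τ * thetaML m l z τ) =
      1 / (2 * Real.pi * Complex.I) := by
    rw [show (-1 : ℂ)⁻¹ = -1 by norm_num, sub_self, zero_mul, sub_zero, neg_one_mul, neg_div,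
      neg_neg]
    simp
  rw [h4] at h3
  refine h3.congr fun u => ?_
  simp only [fTilde, id_eq]
  ring

theorem div_mem_latticeCoset_iff {u z : ℂ} {τ σ : ℍ} (hσ : (σ : ℂ) = -1 / τ) :
    z / τ ∈ latticeCoset (u / τ) σ ↔ z ∈ latticeCoset u τ := by
  have hτ : (τ : ℂ) ≠ 0 := τ.ne_zero
  constructor
  · rintro ⟨k, n, h⟩
    refine ⟨n, -k, ?_⟩
    rw [hσ] at h
    field_simp at h
    push_cast
    linear_combination h
  · rintro ⟨k, n, rfl⟩
    refine ⟨-n, k, ?_⟩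
    rw [hσ]
    push_cast
    field_simp
    ring

theorem im_inversion {τ σ : ℍ} (hσ : (σ : ℂ) = -1 / τ) :
    σ.im = τ.im / Complex.normSq τ := by
  rw [← UpperHalfPlane.coe_im, hσ, neg_div, one_div, Complex.neg_im, Complex.inv_im]
  simp
  ring

theorem dbarConst_inversion {m : ℕ} {τ σ : ℍ} (hσ : (σ : ℂ) = -1 / τ) :
    dbarConst m σ = (‖(τ : ℂ)‖ : ℂ) * dbarConst m τ := by
  have hy := τ.im_pos
  have hτ : (0 : ℝ) < ‖(τ : ℂ)‖ := norm_pos_iff.mpr τ.ne_zero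
  unfold dbarConst
  rw [im_inversion hσ, Complex.normSq_eq_norm_sq, div_right_comm,
    Real.sqrt_div' _ (sq_nonneg _), Real.sqrt_sq hτ.le]
  have h1 : (‖(τ : ℂ)‖ : ℂ) ≠ 0 := by exact_mod_cast hτ.ne'
  have h2 : (τ.im : ℂ) ≠ 0 := by exact_mod_cast hy.ne'
  push_cast
  field_simp

/-- The squared modulus of `exp (2πimu²/τ)` is exactly the quotient of the Gaussian weights at `(u,
τ)` and `(u/τ, σ)`. -/
theorem gaussian_inversion (m : ℕ) (u : ℂ) {τ σ : ℍ} (hσ : (σ : ℂ) = -1 / τ) :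
    Complex.exp (2 * Real.pi * Complex.I * m * u ^ 2 / τ) *
      (starRingEnd ℂ) (Complex.exp (2 * Real.pi * Complex.I * m * u ^ 2 / τ)) *
      (Real.exp (-(4 * Real.pi * m * (u / τ).im ^ 2 / σ.im)) : ℂ) =
    (Real.exp (-(4 * Real.pi * m * u.im ^ 2 / τ.im)) : ℂ) := by
  have hτ : (τ : ℂ) ≠ 0 := τ.ne_zero
  have hy := τ.im_pos
  have hn : Complex.normSq τ ≠ 0 := by simpa using hτ
  obtain ⟨v, rfl⟩ : ∃ v : ℂ, u = v * τ := ⟨u / τ, by field_simp⟩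
  rw [mul_div_cancel_right₀ _ hτ, Complex.mul_conj, Complex.normSq_eq_norm_sq, Complex.norm_exp,
    ← Complex.ofReal_mul, ← Real.exp_nat_mul, ← Real.exp_add, im_inversion hσ]
  congr 2
  have h1 : (2 * Real.pi * Complex.I * m * (v * τ) ^ 2 / τ).re =
      -(2 * Real.pi * m * (v ^ 2 * τ).im) := by
    have : 2 * Real.pi * Complex.I * m * (v * τ) ^ 2 / τ =
        ((2 * Real.pi * m : ℝ) : ℂ) * (Complex.I * (v ^ 2 * τ)) := by
      push_cast
      field_simp
    rw [this, Complex.re_ofReal_mul, Complex.I_mul_re]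
    ring
  rw [h1, Complex.normSq_apply] at *
  simp only [sq, Complex.mul_im, Complex.mul_re, UpperHalfPlane.coe_im, UpperHalfPlane.coe_re] at *
  push_cast
  field_simp
  ring

/-- The defect of the transformation law under `τ ↦ -1 / τ`. -/
noncomputable def inversionDefect (m : ℕ) (z : ℂ) (τ σ : ℍ) (u : ℂ) : ℂ :=
  fTilde m u z τ - (τ : ℂ)⁻¹ * Complex.exp (-(2 * Real.pi * Complex.I * m * (z ^ 2 - u ^ 2) / τ)) *
    fTilde m (u / τ) (z / τ) σ

/-- The antiholomorphic derivatives of the two parts agree: the kernel and `dbarConst` each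
contribute `|τ|`, and `|τ|²` cancels `τ⁻¹` against the conjugate of `τ⁻¹` from the chain rule. -/
theorem differentiableAt_inversionDefect {m : ℕ} (hm : 0 < m) {u z : ℂ} {τ σ : ℍ}
    (hσ : (σ : ℂ) = -1 / τ) (h : z ∉ latticeCoset u τ) :
    DifferentiableAt ℂ (inversionDefect m z τ σ) u := by
  have hτ : (τ : ℂ) ≠ 0 := τ.ne_zero
  have h1 := hasDbar_fTilde_u hm h
  have h2 := (hasDbar_fTilde_u hm (mt (div_mem_latticeCoset_iff hσ).mp h)).comp_div (τ : ℂ)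
  have h3 : DifferentiableAt ℂ (fun u : ℂ => (τ : ℂ)⁻¹ *
    Complex.exp (-(2 * Real.pi * Complex.I * m * (z ^ 2 - u ^ 2) / τ))) u := by fun_prop
  have h4 := h1.sub (HasDbar.mul h3 h2)
  refine HasDbar.differentiableAt ?_
  refine (congrArg (fun b => HasDbar (inversionDefect m z τ σ) b u) ?_).mpr h4
  rw [thetaKernel_inversion hm u z hσ, dbarConst_inversion hσ, eq_comm, sub_eq_zero,
    ← gaussian_inversion m u hσ]
  have h5 : Complex.exp (-(2 * Real.pi * Complex.I * m * (z ^ 2 - u ^ 2) / τ)) *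
      Complex.exp (2 * Real.pi * Complex.I * m * z ^ 2 / τ) =
      Complex.exp (2 * Real.pi * Complex.I * m * u ^ 2 / τ) := by
    rw [← Complex.exp_add]
    congr 1
    ring
  have hc : (starRingEnd ℂ) (τ : ℂ) ≠ 0 := by simpa using hτ
  have h6 : (‖(τ : ℂ)‖ : ℂ) * ‖(τ : ℂ)‖ = τ * (starRingEnd ℂ) (τ : ℂ) := by
    rw [Complex.mul_conj']
    ring
  have h7 : (τ : ℂ)⁻¹ * ((‖(τ : ℂ)‖ : ℂ) * ‖(τ : ℂ)‖) / (starRingEnd ℂ) (τ : ℂ) = 1 := by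
    rw [h6]
    field_simp
  generalize (starRingEnd ℂ) (Complex.exp (2 * Real.pi * Complex.I * m * u ^ 2 / τ)) = e₁
  rw [← h5]
  generalize Complex.exp (-(2 * Real.pi * Complex.I * m * (z ^ 2 - u ^ 2) / τ)) = e₂
  generalize Complex.exp (2 * Real.pi * Complex.I * m * z ^ 2 / τ) = e₃
  generalize (Real.exp (-(4 * Real.pi * m * (u / τ).im ^ 2 / σ.im)) : ℂ) = e₄
  linear_combination (1 / 2 * dbarConst m τ * e₂ * e₃ * e₁ * e₄ * thetaKernel m u z τ) * h7

/-- Division by `τ` turns the translation `kτ + n` into `-nσ + k`, so both parts obey an elliptic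
law in `u`; the exponential prefactor reconciles the two. -/
theorem inversionDefect_add {m : ℕ} (hm : 0 < m) {u z : ℂ} {τ σ : ℍ}
    (hσ : (σ : ℂ) = -1 / τ) (h : z ∉ latticeCoset u τ) (k n : ℤ) :
    inversionDefect m z τ σ (u + k * (τ : ℂ) + n) =
      Complex.exp (2 * Real.pi * Complex.I * m * (k ^ 2 * (τ : ℂ) + 2 * k * u)) *
        inversionDefect m z τ σ u := by
  have hτ : (τ : ℂ) ≠ 0 := τ.ne_zero
  have h1 : (u + k * (τ : ℂ) + n) / τ = u / τ + ((-n : ℤ) : ℂ) * (σ : ℂ) + (k : ℤ) := by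
    rw [hσ]
    push_cast
    field_simp
    ring
  unfold inversionDefect
  rw [h1, fTilde_add_u hm h, fTilde_add_u hm (mt (div_mem_latticeCoset_iff hσ).mp h),
    mul_sub (Complex.exp _)]
  congr 1
  have h2 : Complex.exp (-(2 * Real.pi * Complex.I * m * (z ^ 2 - (u + k * (τ : ℂ) + n) ^ 2) / τ)) *
      Complex.exp (2 * Real.pi * Complex.I * m *
        (((-n : ℤ) : ℂ) ^ 2 * (σ : ℂ) + 2 * ((-n : ℤ) : ℂ) * (u / τ))) =
      Complex.exp (2 * Real.pi * Complex.I * m * (k ^ 2 * (τ : ℂ) + 2 * k * u)) *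
      Complex.exp (-(2 * Real.pi * Complex.I * m * (z ^ 2 - u ^ 2) / τ)) := by
    rw [← Complex.exp_add, ← Complex.exp_add, hσ]
    apply exp_eq_of_int (2 * m * k * n)
    push_cast
    field_simp
    ring
  linear_combination (τ : ℂ)⁻¹ * fTilde m (u / τ) (z / τ) σ * h2

/-- At `u = z` the prefactor `τ⁻¹` absorbs the scaling of the local coordinate and the exponential
is `1`, so equal residues are subtracted. Quasi-periodicity carries this to the other lattice
points. -/
theorem tendsto_sub_mul_inversionDefect {m : ℕ} (hm : 0 < m) {z : ℂ} {τ σ : ℍ}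
    (hσ : (σ : ℂ) = -1 / τ) {p : ℂ} (hp : p ∈ latticeCoset z τ) :
    Filter.Tendsto (fun u => (u - p) * inversionDefect m z τ σ u) (𝓝[≠] p) (𝓝 0) := by
  have hτ : (τ : ℂ) ≠ 0 := τ.ne_zero
  have h0 : Filter.Tendsto (fun u => (u - z) * inversionDefect m z τ σ u) (𝓝[≠] z) (𝓝 0) := by
    have h1 := tendsto_sub_mul_fTilde_u hm z τ
    have h2 := tendsto_sub_mul_fTilde_u hm (z / τ) σ
    have h3 : Filter.Tendsto (fun u : ℂ => u / τ) (𝓝[≠] z) (𝓝[≠] (z / τ)) := by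
      refine tendsto_nhdsWithin_iff.mpr ⟨?_, ?_⟩
      · have : Continuous fun u : ℂ => u / τ := by fun_prop
        exact (this.tendsto z).mono_left nhdsWithin_le_nhds
      · filter_upwards [self_mem_nhdsWithin] with u hu h4
        exact hu ((div_left_inj' hτ).mp h4)
    have h4 : Filter.Tendsto (fun u : ℂ => Complex.exp (-(2 * Real.pi * Complex.I * m *
        (z ^ 2 - u ^ 2) / τ))) (𝓝[≠] z) (𝓝 1) := by
      have : Continuous fun u : ℂ => Complex.exp (-(2 * Real.pi * Complex.I * m *
        (z ^ 2 - u ^ 2) / τ)) := by fun_prop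
      simpa using (this.tendsto z).mono_left nhdsWithin_le_nhds
    have h5 := h1.sub (h4.mul (h2.comp h3))
    rw [one_mul, sub_self] at h5
    refine h5.congr fun u => ?_
    simp only [inversionDefect, Function.comp_apply]
    field_simp
  obtain ⟨k, n, rfl⟩ := hp
  have h1 : Filter.Tendsto (fun u => u - (k * (τ : ℂ) + n)) (𝓝[≠] (z + k * (τ : ℂ) + n))
      (𝓝[≠] z) := by
    refine tendsto_nhdsWithin_iff.mpr ⟨?_, ?_⟩
    · have : Continuous fun u : ℂ => u - (k * (τ : ℂ) + n) := by fun_prop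
      have h2 := (this.tendsto (z + k * (τ : ℂ) + n)).mono_left
        (nhdsWithin_le_nhds (s := {z + k * (τ : ℂ) + n}ᶜ))
      rwa [show z + k * (τ : ℂ) + n - (k * (τ : ℂ) + n) = z by ring] at h2
    · filter_upwards [self_mem_nhdsWithin] with u hu h4
      refine hu ?_
      rw [Set.mem_singleton_iff] at h4 ⊢
      rw [← h4]
      ring
  have h2 : Filter.Tendsto (fun u => Complex.exp (2 * Real.pi * Complex.I * m *
      (k ^ 2 * (τ : ℂ) + 2 * k * (u - (k * (τ : ℂ) + n))))) (𝓝[≠] (z + k * (τ : ℂ) + n))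
      (𝓝 (Complex.exp (2 * Real.pi * Complex.I * m * (k ^ 2 * (τ : ℂ) + 2 * k *
        (z + k * (τ : ℂ) + n - (k * (τ : ℂ) + n)))))) := by
    have : Continuous fun u => Complex.exp (2 * Real.pi * Complex.I * m *
      (k ^ 2 * (τ : ℂ) + 2 * k * (u - (k * (τ : ℂ) + n)))) := by fun_prop
    exact (this.tendsto _).mono_left nhdsWithin_le_nhds
  have h3 := h2.mul (h0.comp h1)
  rw [mul_zero] at h3
  have hε : 0 < min 1 τ.im := lt_min one_pos τ.im_pos
  refine h3.congr' ?_
  filter_upwards [self_mem_nhdsWithin, nhdsWithin_le_nhds (Metric.ball_mem_nhds _ hε)]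
    with u hu hball
  have hnot : z ∉ latticeCoset (u - (k * (τ : ℂ) + n)) τ := by
    intro hmem
    have h4 : u ∈ latticeCoset z τ := by
      obtain ⟨a, b, hab⟩ := hmem
      exact ⟨k - a, n - b, by push_cast; linear_combination -hab⟩
    exact (latticeCoset_pairwise z τ h4 ⟨k, n, rfl⟩ hu).not_gt hball
  have h5 := inversionDefect_add hm hσ hnot k n
  rw [show u - (k * (τ : ℂ) + n) + k * (τ : ℂ) + n = u by ring] at h5
  simp only [Function.comp_apply]
  rw [h5]
  ring

theorem inversionDefect_eq_zero {m : ℕ} (hm : 0 < m) {u z : ℂ} {τ σ : ℍ}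
    (hσ : (σ : ℂ) = -1 / τ) (h : z ∉ latticeCoset u τ) : inversionDefect m z τ σ u = 0 := by
  obtain ⟨F, hF, hFD⟩ := exists_entire_extension (z := z) (τ := τ)
    (D := inversionDefect m z τ σ)
    (fun u hu => differentiableAt_inversionDefect hm hσ (mt mem_latticeCoset_comm.mp hu))
    (fun p hp => tendsto_sub_mul_inversionDefect hm hσ hp)
  rw [← hFD u (mt mem_latticeCoset_comm.mp h)]
  refine eq_zero_of_negative_index hm (τ := τ) hF (fun w k n => ?_) u
  -- The elliptic law is known for the defect only off the lattice; continuity of `F` extends it to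
  -- the whole plane.
  have hdense : Dense (latticeCoset z τ)ᶜ := (latticeCoset_countable z τ).dense_compl ℂ
  have hFc := hF.continuous
  refine congrFun (Continuous.ext_on hdense (f := fun w => F (w + k * (τ : ℂ) + n))
    (g := fun w => Complex.exp (2 * Real.pi * Complex.I * m * (k ^ 2 * (τ : ℂ) + 2 * k * w)) * F w)
    (by fun_prop) (by fun_prop) fun v hv => ?_) w
  have hv' : z ∉ latticeCoset v τ := mt mem_latticeCoset_comm.mp hv
  have hv2 : v + k * (τ : ℂ) + n ∉ latticeCoset z τ :=
    mt mem_latticeCoset_comm.mp (mt (mem_latticeCoset_add_iff k n).mp hv')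
  simp only
  rw [hFD _ hv2, hFD _ hv, inversionDefect_add hm hσ hv']

theorem fTilde_inversion {m : ℕ} (hm : 0 < m) {u z : ℂ} {τ σ : ℍ}
    (hσ : (σ : ℂ) = -1 / τ) (h : z ∉ latticeCoset u τ) :
    fTilde m (u / τ) (z / τ) σ = τ *
      Complex.exp (2 * Real.pi * Complex.I * m * (z ^ 2 - u ^ 2) / τ) * fTilde m u z τ := by
  have hτ : (τ : ℂ) ≠ 0 := τ.ne_zero
  have h1 := sub_eq_zero.mp (inversionDefect_eq_zero hm hσ h)
  rw [h1, Complex.exp_neg]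
  have := Complex.exp_ne_zero (2 * Real.pi * Complex.I * m * (z ^ 2 - u ^ 2) / τ)
  field_simp

/-! ### From the generators to the full modular group -/

theorem coe_smul_eq (γ : SL(2, ℤ)) (τ : ℍ) : ((γ • τ : ℍ) : ℂ) =
    ((γ 0 0 : ℂ) * τ + (γ 0 1 : ℂ)) / ((γ 1 0 : ℂ) * τ + (γ 1 1 : ℂ)) := by
  rw [UpperHalfPlane.coe_specialLinearGroup_apply]
  simp

theorem det_eq_one_complex (γ : SL(2, ℤ)) :
    (γ 0 0 : ℂ) * (γ 1 1 : ℂ) - (γ 0 1 : ℂ) * (γ 1 0 : ℂ) = 1 := by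
  have h := γ.det_coe
  rw [Matrix.det_fin_two] at h
  exact_mod_cast h

theorem factor_ne_zero (γ : SL(2, ℤ)) (τ : ℍ) : (γ 1 0 : ℂ) * τ + (γ 1 1 : ℂ) ≠ 0 := by
  intro h
  have h1 := congrArg Complex.im h
  have h2 : ((γ 1 0 : ℤ) : ℝ) * τ.im = 0 := by simpa using h1
  have h3 : (γ 1 0 : ℂ) = 0 := by
    have : ((γ 1 0 : ℤ) : ℝ) = 0 := (mul_eq_zero.mp h2).resolve_right τ.im_pos.ne'
    exact_mod_cast this
  have h4 := det_eq_one_complex γ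
  rw [h3, zero_mul, zero_add] at h
  rw [h3, h] at h4
  simp at h4

theorem factor_mul (γ δ : SL(2, ℤ)) (τ : ℍ) :
    ((γ * δ) 1 0 : ℂ) * τ + ((γ * δ) 1 1 : ℂ) =
      ((γ 1 0 : ℂ) * (δ • τ : ℍ) + (γ 1 1 : ℂ)) * ((δ 1 0 : ℂ) * τ + (δ 1 1 : ℂ)) := by
  have h := factor_ne_zero δ τ
  rw [coe_smul_eq, Matrix.SpecialLinearGroup.coe_mul, Matrix.mul_apply, Matrix.mul_apply,
    Fin.sum_univ_two, Fin.sum_univ_two, add_mul, mul_assoc, div_mul_cancel₀ _ h]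
  push_cast
  ring

theorem div_factor_notMem {u z : ℂ} {τ : ℍ} (γ : SL(2, ℤ)) (h : z ∉ latticeCoset u τ) :
    z / ((γ 1 0 : ℂ) * τ + (γ 1 1 : ℂ)) ∉
      latticeCoset (u / ((γ 1 0 : ℂ) * τ + (γ 1 1 : ℂ))) (γ • τ) := by
  have hj := factor_ne_zero γ τ
  rintro ⟨k, n, h1⟩
  refine h ⟨k * γ 0 0 + n * γ 1 0, k * γ 0 1 + n * γ 1 1, ?_⟩
  rw [coe_smul_eq] at h1
  field_simp at h1
  push_cast
  linear_combination h1

/-- The transformation law of `f̃` under `γ`. -/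
def TransformsUnder (m : ℕ) (γ : SL(2, ℤ)) : Prop :=
  ∀ (u z : ℂ) (τ : ℍ), z ∉ latticeCoset u τ →
    fTilde m (u / ((γ 1 0 : ℂ) * τ + (γ 1 1 : ℂ)))
        (z / ((γ 1 0 : ℂ) * τ + (γ 1 1 : ℂ))) (γ • τ) =
      ((γ 1 0 : ℂ) * τ + (γ 1 1 : ℂ)) *
        Complex.exp (2 * Real.pi * Complex.I * m * (γ 1 0 : ℂ) * (z ^ 2 - u ^ 2) /
          ((γ 1 0 : ℂ) * τ + (γ 1 1 : ℂ))) * fTilde m u z τ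

theorem TransformsUnder.mul {m : ℕ} {γ δ : SL(2, ℤ)} (hγ : TransformsUnder m γ)
    (hδ : TransformsUnder m δ) : TransformsUnder m (γ * δ) := by
  intro u z τ h
  have hj := factor_ne_zero δ τ
  have hj' := factor_ne_zero γ (δ • τ)
  rw [factor_mul, mul_comm ((γ 1 0 : ℂ) * (δ • τ : ℍ) + (γ 1 1 : ℂ)), ← div_div, ← div_div,
    mul_smul, hγ _ _ _ (div_factor_notMem δ h), hδ _ _ _ h]
  -- This relation, a consequence of `det δ = 1`, makes the exponents of the two automorphy factors
  -- add up.
  have h1 : ((γ * δ) 1 0 : ℂ) * ((δ 1 0 : ℂ) * τ + (δ 1 1 : ℂ)) = (γ 1 0 : ℂ) +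
      (δ 1 0 : ℂ) * (((γ 1 0 : ℂ) * (δ • τ : ℍ) + (γ 1 1 : ℂ)) *
        ((δ 1 0 : ℂ) * τ + (δ 1 1 : ℂ))) := by
    rw [coe_smul_eq, Matrix.SpecialLinearGroup.coe_mul, Matrix.mul_apply, Fin.sum_univ_two]
    field_simp
    push_cast
    linear_combination (γ 1 0 : ℂ) * det_eq_one_complex δ
  have h2 : Complex.exp (2 * Real.pi * Complex.I * m * ((γ * δ) 1 0 : ℂ) * (z ^ 2 - u ^ 2) /
      (((δ 1 0 : ℂ) * τ + (δ 1 1 : ℂ)) * ((γ 1 0 : ℂ) * (δ • τ : ℍ) + (γ 1 1 : ℂ)))) =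
      Complex.exp (2 * Real.pi * Complex.I * m * (γ 1 0 : ℂ) *
        ((z / ((δ 1 0 : ℂ) * τ + (δ 1 1 : ℂ))) ^ 2 - (u / ((δ 1 0 : ℂ) * τ + (δ 1 1 : ℂ))) ^ 2) /
        ((γ 1 0 : ℂ) * (δ • τ : ℍ) + (γ 1 1 : ℂ))) *
      Complex.exp (2 * Real.pi * Complex.I * m * (δ 1 0 : ℂ) * (z ^ 2 - u ^ 2) /
          ((δ 1 0 : ℂ) * τ + (δ 1 1 : ℂ))) := by
    rw [← Complex.exp_add]
    congr 1
    generalize (γ 1 0 : ℂ) * (δ • τ : ℍ) + (γ 1 1 : ℂ) = j' at *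
    generalize (δ 1 0 : ℂ) * (τ : ℂ) + (δ 1 1 : ℂ) = j at *
    have h3 : ((γ * δ) 1 0 : ℂ) = ((γ 1 0 : ℂ) + (δ 1 0 : ℂ) * (j' * j)) / j := by
      rw [← h1]
      field_simp
    rw [h3]
    field_simp
  rw [h2]
  ring

theorem TransformsUnder.inv {m : ℕ} {γ : SL(2, ℤ)} (hγ : TransformsUnder m γ) :
    TransformsUnder m γ⁻¹ := by
  intro u z τ h
  have hj := factor_ne_zero γ⁻¹ τ
  have h1 := hγ _ _ _ (div_factor_notMem γ⁻¹ h)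
  have h2 := factor_mul γ γ⁻¹ τ
  have h3 : ((γ⁻¹ 1 0 : ℤ) : ℂ) = -(γ 1 0 : ℂ) := by
    rw [Matrix.SpecialLinearGroup.SL2_inv_expl]
    simp
  rw [mul_inv_cancel] at h2
  simp only [Matrix.SpecialLinearGroup.coe_one, Matrix.one_apply_eq, Int.cast_one, ne_eq,
    one_ne_zero, not_false_eq_true, Matrix.one_apply_ne, Int.cast_zero, zero_mul, zero_add] at h2
  rw [smul_inv_smul] at h1
  generalize (γ 1 0 : ℂ) * (γ⁻¹ • τ : ℍ) + (γ 1 1 : ℂ) = j' at *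
  generalize (γ⁻¹ 1 0 : ℂ) * (τ : ℂ) + (γ⁻¹ 1 1 : ℂ) = j at *
  rw [h3]
  have h4 : j' = j⁻¹ := eq_inv_of_mul_eq_one_left h2.symm
  rw [h4, div_div, div_div, mul_inv_cancel₀ hj, div_one, div_one] at h1
  have h5 : Complex.exp (2 * Real.pi * Complex.I * m * -(γ 1 0 : ℂ) * (z ^ 2 - u ^ 2) / j) *
      Complex.exp (2 * Real.pi * Complex.I * m * (γ 1 0 : ℂ) *
        ((z / j) ^ 2 - (u / j) ^ 2) / j⁻¹) = 1 := by
    rw [← Complex.exp_add, ← Complex.exp_zero]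
    congr 1
    field_simp
    ring
  rw [h1]
  have h6 : j * j⁻¹ = 1 := mul_inv_cancel₀ hj
  linear_combination (-(j * j⁻¹) * fTilde m (u / j) (z / j) (γ⁻¹ • τ)) * h5 -
    fTilde m (u / j) (z / j) (γ⁻¹ • τ) * h6

theorem transformsUnder_one (m : ℕ) : TransformsUnder m 1 := by
  intro u z τ _
  simp

theorem transformsUnder_S {m : ℕ} (hm : 0 < m) : TransformsUnder m ModularGroup.S := by
  intro u z τ h
  have hσ : ((ModularGroup.S • τ : ℍ) : ℂ) = -1 / τ := by
    rw [coe_smul_eq]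
    simp [ModularGroup.S]
  have h1 := fTilde_inversion hm hσ h
  simpa [ModularGroup.S] using h1

/-- Each term of `θ` and `R` acquires a phase governed by `k²` modulo `4m`, which depends only on
the class of `k` modulo `2m`; the phases of `θ` and `R` are inverse, and `Im τ` does not change. -/
theorem fTilde_add_one_tau {m : ℕ} (hm : 0 < m) (u z : ℂ) {τ σ : ℍ} (hσ : (σ : ℂ) = τ + 1) :
    fTilde m u z σ = fTilde m u z τ := by
  have hmc : (m : ℂ) ≠ 0 := by exact_mod_cast hm.ne'
  have him : σ.im = τ.im := by
    rw [← UpperHalfPlane.coe_im, hσ]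
    simp
  have h1 : f m u z σ = f m u z τ := by
    refine tsum_congr fun k => ?_
    unfold fTerm
    rw [hσ]
    congr 1
    · apply exp_eq_of_int (m * k ^ 2)
      push_cast
      ring
    · congr 1
      apply exp_eq_of_int k
      ring
  have hres : ∀ {k l : ℤ}, k ≡ l [ZMOD (2 * m : ℤ)] → ∃ p : ℤ, (k : ℂ) = l + 2 * m * p := by
    intro k l hkl
    obtain ⟨p, hp⟩ := hkl.symm.dvd
    refine ⟨p, ?_⟩
    rw [show k = l + 2 * m * p by lia]
    push_cast
    ring
  have h2 : ∀ l : ℤ, thetaML m l z σ =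
      Complex.exp (Real.pi * Complex.I * l ^ 2 / (2 * m)) * thetaML m l z τ := fun l => by
    unfold thetaML
    rw [← tsum_mul_left]
    refine tsum_congr fun k => ?_
    obtain ⟨p, hp⟩ := hres k.2
    unfold thetaTerm
    rw [hσ, hp, ← Complex.exp_add]
    apply exp_eq_of_int (l * p + m * p ^ 2)
    push_cast
    field_simp
    ring
  have h3 : ∀ l : ℤ, RML m l u σ =
      Complex.exp (-(Real.pi * Complex.I * l ^ 2 / (2 * m))) * RML m l u τ := fun l => by
    unfold RML
    rw [← tsum_mul_left]
    refine tsum_congr fun k => ?_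
    obtain ⟨p, hp⟩ := hres k.2
    have h4 : corr m u σ k = Complex.exp (-(Real.pi * Complex.I * l ^ 2 / (2 * m))) *
        corr m u τ k := by
      unfold corr
      rw [hσ, hp, ← Complex.exp_add]
      apply exp_eq_of_int (-(l * p + m * p ^ 2))
      push_cast
      field_simp
      ring
    rw [RTerm_eq_corr, RTerm_eq_corr, h4, him]
    ring
  unfold fTilde
  rw [h1]
  congr 2
  refine Finset.sum_congr rfl fun l _ => ?_
  rw [h2, h3, Complex.exp_neg]
  have := Complex.exp_ne_zero (Real.pi * Complex.I * ((l : ℤ) : ℂ) ^ 2 / (2 * m))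
  field_simp

theorem transformsUnder_T {m : ℕ} (hm : 0 < m) : TransformsUnder m ModularGroup.T := by
  intro u z τ _
  have hσ : ((ModularGroup.T • τ : ℍ) : ℂ) = τ + 1 := by
    rw [coe_smul_eq]
    simp [ModularGroup.T]
  have h1 := fTilde_add_one_tau hm u z hσ
  simpa [ModularGroup.T] using h1

theorem transformsUnder {m : ℕ} (hm : 0 < m) (γ : SL(2, ℤ)) : TransformsUnder m γ := by
  have h : γ ∈ Subgroup.closure {ModularGroup.S, ModularGroup.T} := by
    rw [SpecialLinearGroup.SL2Z_generators]
    exact Subgroup.mem_top γ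
  induction h using Subgroup.closure_induction with
  | mem x hx =>
    rcases hx with rfl | rfl
    · exact transformsUnder_S hm
    · exact transformsUnder_T hm
  | one => exact transformsUnder_one m
  | mul x y _ _ hx hy => exact hx.mul hy
  | inv x _ hx => exact hx.inv

/-! ### The quadratic form of `(2m 1; 1 0)` -/

theorem bilB_blockA {K : Type} [Field K] (m : ℕ) (x y : Fin 2 → K) :
    bilB (blockA m) x y = 2 * m * x 0 * y 0 + x 0 * y 1 + x 1 * y 0 := by
  simp [bilB, blockA, dotProduct, Matrix.mulVec, Fin.sum_univ_two]
  ring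

theorem quadQ_blockA {K : Type} [Field K] [CharZero K] (m : ℕ) (x : Fin 2 → K) :
    quadQ (blockA m) x = m * x 0 ^ 2 + x 0 * x 1 := by
  rw [quadQ, bilB_blockA]
  field_simp
  ring

theorem quadQ_blockC₁ (m : ℕ) : quadQ (blockA m) blockC₁ = 0 := by
  rw [quadQ_blockA]
  simp [blockC₁]

theorem quadQ_blockC₂ (m : ℕ) : quadQ (blockA m) (blockC₂ m) = -m := by
  rw [quadQ_blockA]
  simp [blockC₂]
  ring

theorem bilB_blockC₁ (m : ℕ) (ν : Fin 2 → ℝ) : bilB (blockA m) blockC₁ ν = ν 0 := by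
  rw [bilB_blockA]
  simp [blockC₁]

theorem bilB_blockC₂ (m : ℕ) (ν : Fin 2 → ℝ) : bilB (blockA m) (blockC₂ m) ν = -ν 1 := by
  rw [bilB_blockA]
  simp [blockC₂]

/-- The line through `blockC₂` is negative, as `Q` is `-m` there. A larger negative subspace would
be the whole plane, which contains the isotropic vector `blockC₁`. -/
theorem isOfTypeOne_blockA {m : ℕ} (hm : 0 < m) : IsOfTypeOne (blockA m) := by
  refine ⟨?_, ?_, ?_, ?_⟩
  · ext i j
    fin_cases i <;> fin_cases j <;> simp [blockA]
  · simp [blockA]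
  · have hne : blockC₂ m ≠ 0 := fun h => by simpa [blockC₂] using congrFun h 0
    refine ⟨Submodule.span ℝ {blockC₂ m}, finrank_span_singleton hne, fun x hx hx0 => ?_⟩
    obtain ⟨a, rfl⟩ := Submodule.mem_span_singleton.mp hx
    have ha : a ≠ 0 := fun h => hx0 (by rw [h, zero_smul])
    have h1 : quadQ (blockA m) (a • blockC₂ m) = a ^ 2 * quadQ (blockA m) (blockC₂ m) := by
      rw [quadQ_blockA, quadQ_blockA]
      simp only [Pi.smul_apply, smul_eq_mul]
      ring
    rw [h1, quadQ_blockC₂]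
    have : (0 : ℝ) < m := by exact_mod_cast hm
    have := pow_pos (abs_pos.mpr ha) 2
    rw [sq_abs] at this
    nlinarith
  · rintro d ⟨W, rfl, hW⟩
    by_contra! hd
    have hle : Module.finrank ℝ W ≤ Module.finrank ℝ (Fin 2 → ℝ) := W.finrank_le
    rw [Module.finrank_fin_fun] at hle
    have htop : W = ⊤ := Submodule.eq_top_of_finrank_eq (by
      rw [Module.finrank_fin_fun]
      lia)
    have hne : blockC₁ ≠ 0 := fun h => by simpa [blockC₁] using congrFun h 1
    have := hW blockC₁ (by rw [htop]; exact Submodule.mem_top) hne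
    rw [quadQ_blockC₁] at this
    exact lt_irrefl _ this

theorem blockC₁_mem_cuspS (m : ℕ) :
    blockC₁ ∈ cuspS (blockA m) (blockC₂ m) := by
  refine ⟨⟨![0, 1], ?_, ?_⟩, quadQ_blockC₁ m, ?_⟩
  · rfl
  · funext i
    fin_cases i <;> simp [blockC₁]
  · rw [bilB_blockC₁]
    simp [blockC₂]

theorem blockC₂_mem_coneC {m : ℕ} (hm : 0 < m) :
    blockC₂ m ∈ coneC (blockA m) (blockC₂ m) := by
  have : (0 : ℝ) < m := by exact_mod_cast hm
  refine ⟨?_, ?_⟩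
  · rw [quadQ_blockC₂]
    linarith
  · rw [bilB_blockC₂]
    simp [blockC₂, hm]

theorem mem_domainD_iff {m : ℕ} (hm : 0 < m) (u z : ℂ) (τ : ℍ) :
    (![z - u, 2 * m * u], τ) ∈ domainD (blockA m) blockC₁ ∩ domainD (blockA m) (blockC₂ m) ↔
      ∀ n : ℤ, (z - u).im / τ.im ≠ n := by
  have h2 : (![z - u, 2 * m * u], τ) ∈ domainD (blockA m) (blockC₂ m) :=
    Or.inl (blockC₂_mem_coneC hm).1
  rw [Set.mem_inter_iff, and_iff_left h2, domainD, Set.mem_ofPred_eq, quadQ_blockC₁]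
  simp only [lt_self_iff_false, false_or, bilB_blockC₁]
  rfl

/-! ### The geometric part -/

theorem sign_add_sign {ν : ℝ} (hν : ν ≠ 0) (n : ℤ) : Real.sign ν + Real.sign ((n : ℝ) + 1 / 2) =
    if 0 < ν then (if 0 ≤ n then 2 else 0) else if 0 ≤ n then 0 else -2 := by
  rw [sign_int_add_half]
  rcases lt_or_gt_of_ne hν with h | h
  · rw [Real.sign_of_neg h, if_neg h.not_gt]
    split_ifs <;> norm_num
  · rw [Real.sign_of_pos h, if_pos h]
    split_ifs <;> norm_num

/-- The two signs add to `2` on `n ≥ 0` if `ν > 0` and to `-2` on `n < 0` if `ν < 0`, and vanish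
elsewhere: the expansion of `2 / (1 - w)` in powers of `w` or of `w⁻¹`, whichever converges. -/
theorem hasSum_sign_geometric {ν : ℝ} (hν : ν ≠ 0) {c : ℂ} (hpos : 0 < ν → c.re < 0)
    (hneg : ν < 0 → 0 < c.re) :
    HasSum (fun n : ℤ => ((Real.sign ν + Real.sign ((n : ℝ) + 1 / 2) : ℝ) : ℂ) *
      Complex.exp (n * c)) (2 / (1 - Complex.exp c)) := by
  simp_rw [sign_add_sign hν]
  rcases lt_or_gt_of_ne hν with h | h
  · have hnorm : ‖Complex.exp (-c)‖ < 1 := by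
      rw [Complex.norm_exp, Real.exp_lt_one_iff, Complex.neg_re]
      linarith [hneg h]
    have h1 : HasSum (fun n : ℕ => ((if 0 < ν then (if 0 ≤ (n : ℤ) then 2 else 0) else
        if 0 ≤ (n : ℤ) then 0 else -2 : ℝ) : ℂ) * Complex.exp (((n : ℤ) : ℂ) * c)) 0 := by
      simp [h.not_gt, hasSum_zero]
    have h2 : HasSum (fun n : ℕ => ((if 0 < ν then (if 0 ≤ (-((n : ℤ) + 1)) then 2 else 0) else
        if 0 ≤ (-((n : ℤ) + 1)) then 0 else -2 : ℝ) : ℂ) *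
          Complex.exp (((-((n : ℤ) + 1) : ℤ) : ℂ) * c))
        (-2 * Complex.exp (-c) * (1 - Complex.exp (-c))⁻¹) := by
      refine ((hasSum_geometric_of_norm_lt_one hnorm).mul_left (-2 * Complex.exp (-c))).congr_fun ?_
      intro n
      rw [if_neg h.not_gt, if_neg (by lia), ← Complex.exp_nat_mul, mul_assoc, ← Complex.exp_add]
      push_cast
      ring_nf
    have h3 := HasSum.of_nat_of_neg_add_one (f := fun n : ℤ => ((if 0 < ν then
      (if 0 ≤ n then 2 else 0) else if 0 ≤ n then 0 else -2 : ℝ) : ℂ) * Complex.exp (n * c)) h1 h2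
    convert h3 using 1
    have he := Complex.exp_ne_zero c
    have h4 : Complex.exp (-c) ≠ 1 := fun h0 => by
      rw [h0, norm_one] at hnorm
      exact lt_irrefl _ hnorm
    rw [Complex.exp_neg] at *
    have h5 : Complex.exp c ≠ 1 := fun h0 => h4 (by rw [h0, inv_one])
    have h6 := sub_ne_zero.mpr h5
    have h7 := sub_ne_zero.mpr h5.symm
    have h8 : 1 - (Complex.exp c)⁻¹ = (Complex.exp c - 1) / Complex.exp c := by field_simp
    rw [h8]
    field_simp
    ring
  · have hnorm : ‖Complex.exp c‖ < 1 := by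
      rw [Complex.norm_exp, Real.exp_lt_one_iff]
      exact hpos h
    have h1 : HasSum (fun n : ℕ => ((if 0 < ν then (if 0 ≤ (n : ℤ) then 2 else 0) else
        if 0 ≤ (n : ℤ) then 0 else -2 : ℝ) : ℂ) * Complex.exp (((n : ℤ) : ℂ) * c))
        (2 * (1 - Complex.exp c)⁻¹) := by
      refine ((hasSum_geometric_of_norm_lt_one hnorm).mul_left 2).congr_fun ?_
      intro n
      rw [if_pos h, if_pos (by lia), ← Complex.exp_nat_mul]
      push_cast
      rfl
    have h2 : HasSum (fun n : ℕ => ((if 0 < ν then (if 0 ≤ (-((n : ℤ) + 1)) then 2 else 0) else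
        if 0 ≤ (-((n : ℤ) + 1)) then 0 else -2 : ℝ) : ℂ) *
          Complex.exp (((-((n : ℤ) + 1) : ℤ) : ℂ) * c)) 0 := by
      refine hasSum_zero.congr_fun ?_
      intro n
      rw [if_pos h, if_neg (by lia)]
      simp
    have h3 := HasSum.of_nat_of_neg_add_one (f := fun n : ℤ => ((if 0 < ν then
      (if 0 ≤ n then 2 else 0) else if 0 ≤ n then 0 else -2 : ℝ) : ℂ) * Complex.exp (n * c)) h1 h2
    rw [add_zero, ← div_eq_mul_inv] at h3
    exact h3

/-- All nonzero coefficients have the sign of `ν`, so the norms form the same series with `c`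
replaced by its real part. -/
theorem hasSum_norm_sign_geometric {ν : ℝ} (hν : ν ≠ 0) {c : ℂ} (hpos : 0 < ν → c.re < 0)
    (hneg : ν < 0 → 0 < c.re) :
    HasSum (fun n : ℤ => ‖((Real.sign ν + Real.sign ((n : ℝ) + 1 / 2) : ℝ) : ℂ) *
      Complex.exp (n * c)‖) (Real.sign ν * (2 / (1 - Real.exp c.re))) := by
  have h1 := (hasSum_sign_geometric hν (c := (c.re : ℂ)) (by simpa using hpos)
    (by simpa using hneg)).mul_left (Real.sign ν : ℂ)
  have h2 : HasSum (fun n : ℤ => ((Real.sign ν * ((Real.sign ν + Real.sign ((n : ℝ) + 1 / 2)) *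
      Real.exp (n * c.re)) : ℝ) : ℂ)) ((Real.sign ν * (2 / (1 - Real.exp c.re)) : ℝ) : ℂ) := by
    push_cast at h1 ⊢
    exact h1
  refine (Complex.hasSum_ofReal.mp h2).congr_fun fun n => ?_
  rw [norm_mul, Complex.norm_real, Complex.norm_exp, Real.norm_eq_abs, sign_add_sign hν]
  have h3 : ((n : ℂ) * c).re = n * c.re := by
    rw [← Complex.ofReal_intCast, Complex.re_ofReal_mul]
  rw [h3]
  rcases lt_or_gt_of_ne hν with h | h
  · rw [Real.sign_of_neg h, if_neg h.not_gt]
    split_ifs <;> simp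
  · rw [Real.sign_of_pos h, if_pos h]
    split_ifs <;> simp

/-! ### Comparison with the indefinite theta series -/

/-- The exponential factor of the terms of the indefinite theta series. -/
noncomputable def latticeExp (m : ℕ) (u z : ℂ) (τ : ℍ) (p : ℤ × ℤ) : ℂ :=
  Complex.exp (2 * Real.pi * Complex.I * m * p.1 ^ 2 * τ + 4 * Real.pi * Complex.I * m * p.1 * z) *
    Complex.exp (p.2 * (2 * Real.pi * Complex.I * p.1 * τ + 2 * Real.pi * Complex.I * (z - u)))

/-- The part of the indefinite theta series that sums to `2 f`. -/
noncomputable def geomTerm (m : ℕ) (u z : ℂ) (τ : ℍ) (p : ℤ × ℤ) : ℂ :=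
  ((Real.sign ((p.1 : ℝ) + (z - u).im / τ.im) + Real.sign ((p.2 : ℝ) + 1 / 2) : ℝ) : ℂ) *
    latticeExp m u z τ p

/-- The quadratic form diagonalizes as `mk² + kn = ((n + 2mk)² - n²) / 4m`, which separates `u` from
`z`. -/
theorem latticeExp_eq {m : ℕ} (hm : 0 < m) (u z : ℂ) (τ : ℍ) (p : ℤ × ℤ) :
    latticeExp m u z τ p = corr m u τ p.2 * thetaTerm m z τ (p.2 + 2 * m * p.1) := by
  have hmc : (m : ℂ) ≠ 0 := by exact_mod_cast hm.ne'
  unfold latticeExp corr thetaTerm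
  rw [← Complex.exp_add, ← Complex.exp_add]
  congr 1
  push_cast
  field_simp
  ring

/-- As `E` is odd and `B (c₂, ν) = -ν 1`, the weight is a sum `sign + E`; adding and subtracting
`sign (n 1 + 1/2)` splits it. -/
theorem indefThetaTerm_eq {m : ℕ} (hm : 0 < m) (u z : ℂ) (τ : ℍ) (n : Fin 2 → ℤ) :
    indefThetaTerm (blockA m) blockC₁ (blockC₂ m) ![z - u, 2 * m * u] τ n =
      geomTerm m u z τ (n 0, n 1) -
        RTerm m u τ (n 1) * thetaTerm m z τ (n 1 + 2 * m * n 0) := by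
  have hm' : (0 : ℝ) < m := by exact_mod_cast hm
  have hy := τ.im_pos
  have h1 : rho (blockA m) blockC₁ (blockC₂ m)
      (fun i => (n i : ℝ) + ((![z - u, 2 * m * u] : Fin 2 → ℂ) i).im / τ.im) τ =
      Real.sign ((n 0 : ℝ) + (z - u).im / τ.im) +
        E (((n 1 : ℝ) + 2 * m * u.im / τ.im) * Real.sqrt (τ.im / m)) := by
    have h2 : (2 * m * u).im = 2 * m * u.im := im_two_mul_nat_mul m u
    rw [rho, rhoC, rhoC, quadQ_blockC₁, quadQ_blockC₂, if_neg (lt_irrefl _),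
      if_pos (neg_neg_of_pos hm'), bilB_blockC₁, bilB_blockC₂, sub_eq_add_neg, ← E_neg, neg_neg,
      Real.sqrt_div hy.le]
    congr 2
    simp only [Matrix.cons_val_one, Matrix.cons_val_fin_one, h2]
    ring
  have h3 : Complex.exp (2 * Real.pi * Complex.I * quadQ (blockA m) (fun i => (n i : ℂ)) * τ +
      2 * Real.pi * Complex.I * bilB (blockA m) (fun i => (n i : ℂ)) ![z - u, 2 * m * u]) =
      latticeExp m u z τ (n 0, n 1) := by
    rw [latticeExp, ← Complex.exp_add, quadQ_blockA, bilB_blockA]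
    congr 1
    simp only [Matrix.cons_val_one, Matrix.cons_val_zero, Matrix.cons_val_fin_one]
    ring
  have h4 := latticeExp_eq hm u z τ (n 0, n 1)
  dsimp only at h4
  rw [indefThetaTerm, h1, h3, RTerm_eq_corr, geomTerm, mul_assoc (Complex.ofReal _), ← h4, Complex.ofReal_add,
    Complex.ofReal_add, Complex.ofReal_sub]
  ring

theorem re_lattice_exponent (u z : ℂ) (τ : ℍ) (k : ℤ) :
    (2 * Real.pi * Complex.I * k * τ + 2 * Real.pi * Complex.I * (z - u)).re =
      -(2 * Real.pi * τ.im * (k + (z - u).im / τ.im)) := by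
  have hy := τ.im_pos.ne'
  have := norm_exp_lattice u z τ k
  rw [Complex.norm_exp, Real.exp_eq_exp] at this
  rw [this]
  field_simp

theorem int_add_ne_zero {t : ℝ} (h : ∀ n : ℤ, t ≠ n) (k : ℤ) : (k : ℝ) + t ≠ 0 := fun h0 =>
  h (-k) (by push_cast; linarith)

theorem hasSum_geomTerm {m : ℕ} {u z : ℂ} {τ : ℍ} (h : ∀ n : ℤ, (z - u).im / τ.im ≠ n) (k : ℤ) :
    HasSum (fun n : ℤ => geomTerm m u z τ (k, n)) (2 * fTerm m u z τ k) := by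
  have hpy : 0 < 2 * Real.pi * τ.im := mul_pos Real.two_pi_pos τ.im_pos
  have h1 := (hasSum_sign_geometric (int_add_ne_zero h k)
    (c := 2 * Real.pi * Complex.I * k * τ + 2 * Real.pi * Complex.I * (z - u))
    (fun hp => by rw [re_lattice_exponent]; nlinarith [mul_pos hpy hp])
    (fun hp => by rw [re_lattice_exponent]; nlinarith [mul_neg_of_pos_of_neg hpy hp])).mul_left
    (Complex.exp (2 * Real.pi * Complex.I * m * k ^ 2 * τ + 4 * Real.pi * Complex.I * m * k * z))
  rw [show ∀ a b : ℂ, a * (2 / b) = 2 * (a / b) from fun a b => by ring] at h1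
  refine h1.congr_fun fun n => ?_
  unfold geomTerm latticeExp
  ring

theorem summable_geomTerm {m : ℕ} (hm : 0 < m) {u z : ℂ} {τ : ℍ}
    (h : ∀ n : ℤ, (z - u).im / τ.im ≠ n) : Summable (geomTerm m u z τ) := by
  have hpy : 0 < 2 * Real.pi * τ.im := mul_pos Real.two_pi_pos τ.im_pos
  have hsum : ∀ k : ℤ, HasSum (fun n : ℤ => ‖geomTerm m u z τ (k, n)‖)
      (‖Complex.exp (2 * Real.pi * Complex.I * m * k ^ 2 * τ +
        4 * Real.pi * Complex.I * m * k * z)‖ * (Real.sign ((k : ℝ) + (z - u).im / τ.im) *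
          (2 / (1 - Real.exp (2 * Real.pi * Complex.I * k * τ +
            2 * Real.pi * Complex.I * (z - u)).re)))) := fun k => by
    have h1 := (hasSum_norm_sign_geometric (int_add_ne_zero h k)
      (c := 2 * Real.pi * Complex.I * k * τ + 2 * Real.pi * Complex.I * (z - u))
      (fun hp => by rw [re_lattice_exponent]; nlinarith [mul_pos hpy hp])
      (fun hp => by rw [re_lattice_exponent]; nlinarith [mul_neg_of_pos_of_neg hpy hp])).mul_left
      ‖Complex.exp (2 * Real.pi * Complex.I * m * k ^ 2 * τ + 4 * Real.pi * Complex.I * m * k * z)‖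
    refine h1.congr_fun fun n => ?_
    unfold geomTerm latticeExp
    rw [norm_mul, norm_mul, norm_mul]
    ring
  refine Summable.of_norm ((summable_prod_of_nonneg fun p => norm_nonneg _).mpr
    ⟨fun k => (hsum k).summable, ?_⟩)
  simp_rw [fun k => (hsum k).tsum_eq]
  -- The inner sums of norms have the modulus of twice the terms of `f` at the purely imaginary data
  -- `i Im τ`, `i Im u`, `i Im z`, so convergence of `f` itself settles the outer sum.
  let σ : ℍ := ⟨Complex.I * τ.im, by simpa using τ.im_pos⟩
  have hs := (summable_fTerm hm (Complex.I * u.im) (Complex.I * z.im) σ).norm.mul_left 2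
  refine Summable.of_norm_bounded hs fun k => ?_
  have hσ : (σ : ℂ) = Complex.I * τ.im := rfl
  have hc : 2 * Real.pi * Complex.I * k * (σ : ℂ) +
      2 * Real.pi * Complex.I * (Complex.I * z.im - Complex.I * u.im) =
      (((2 * Real.pi * Complex.I * k * τ + 2 * Real.pi * Complex.I * (z - u)).re : ℝ) : ℂ) := by
    have hy : (τ.im : ℂ) ≠ 0 := by exact_mod_cast τ.im_pos.ne'
    rw [re_lattice_exponent, hσ, Complex.sub_im]
    push_cast
    field_simp
    ring_nf
    simp only [Complex.I_sq]
    ring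
  have hN : ‖Complex.exp (2 * Real.pi * Complex.I * m * k ^ 2 * σ +
      4 * Real.pi * Complex.I * m * k * (Complex.I * z.im))‖ =
      ‖Complex.exp (2 * Real.pi * Complex.I * m * k ^ 2 * τ +
        4 * Real.pi * Complex.I * m * k * z)‖ := by
    rw [Complex.norm_exp, Complex.norm_exp, hσ]
    congr 1
    have : ∀ w x : ℂ, (2 * Real.pi * Complex.I * m * k ^ 2 * w +
        4 * Real.pi * Complex.I * m * k * x).re =
        -(2 * Real.pi * m * k ^ 2 * w.im + 4 * Real.pi * m * k * x.im) := fun w x => by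
      have : 2 * Real.pi * Complex.I * m * k ^ 2 * w + 4 * Real.pi * Complex.I * m * k * x =
          ((2 * Real.pi * m * k ^ 2 : ℝ) : ℂ) * (Complex.I * w) +
          ((4 * Real.pi * m * k : ℝ) : ℂ) * (Complex.I * x) := by
        push_cast
        ring
      rw [this, Complex.add_re, Complex.re_ofReal_mul, Complex.re_ofReal_mul, Complex.I_mul_re,
        Complex.I_mul_re]
      ring
    rw [this, this]
    simp
  rw [fTerm, hc, norm_div, hN, norm_mul, norm_norm, norm_mul, norm_div, Real.norm_two]
  have h1 : ‖(1 : ℂ) - Complex.exp (((2 * Real.pi * Complex.I * k * τ +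
      2 * Real.pi * Complex.I * (z - u)).re : ℝ) : ℂ)‖ = ‖1 - Real.exp (2 * Real.pi * Complex.I *
        k * τ + 2 * Real.pi * Complex.I * (z - u)).re‖ := by
    rw [← Complex.norm_real]
    push_cast
    rfl
  rw [h1]
  have h2 : ‖Real.sign ((k : ℝ) + (z - u).im / τ.im)‖ = 1 := by
    rcases lt_or_gt_of_ne (int_add_ne_zero h k) with h3 | h3
    · rw [Real.sign_of_neg h3]
      simp
    · rw [Real.sign_of_pos h3]
      simp
  rw [h2]
  apply le_of_eq
  ring

theorem tsum_geomTerm {m : ℕ} (hm : 0 < m) {u z : ℂ} {τ : ℍ}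
    (h : ∀ n : ℤ, (z - u).im / τ.im ≠ n) :
    ∑' p, geomTerm m u z τ p = 2 * f m u z τ := by
  rw [(summable_geomTerm hm h).tsum_prod' fun k => (hasSum_geomTerm h k).summable, f,
    ← tsum_mul_left]
  exact tsum_congr fun k => (hasSum_geomTerm h k).tsum_eq

theorem summable_RTerm_mul_thetaTerm {m : ℕ} (hm : 0 < m) (u z : ℂ) (τ : ℍ) :
    Summable fun p : ℤ × ℤ => RTerm m u τ p.2 * thetaTerm m z τ (p.2 + 2 * m * p.1) := by
  have h1 := summable_mul_of_summable_norm (summable_RTerm hm u τ).norm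
    (summable_thetaTerm hm z τ).norm
  have hinj : Function.Injective fun p : ℤ × ℤ => (p.2, p.2 + 2 * m * p.1) := by
    rintro ⟨a, b⟩ ⟨c, d⟩ hp
    simp only [Prod.mk.injEq] at hp
    obtain ⟨rfl, h3⟩ := hp
    rw [injective_residue hm b h3]
  have h2 := h1.comp_injective hinj
  exact h2

theorem thetaML_congr {m : ℕ} {k l : ℤ} (h : k ≡ l [ZMOD (2 * m : ℤ)]) (z : ℂ) (τ : ℍ) :
    thetaML m k z τ = thetaML m l z τ := by
  have h1 : (fun j : ℤ => j ≡ k [ZMOD (2 * m : ℤ)]) = fun j : ℤ => j ≡ l [ZMOD (2 * m : ℤ)] := by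
    funext j
    exact propext ⟨fun hj => hj.trans h, fun hj => hj.trans h.symm⟩
  unfold thetaML
  rw [h1]

/-- For a fixed index of `R` the inner sum is a theta function depending only on that index modulo
`2m`, so the outer sum can be grouped by residues. -/
theorem tsum_RTerm_mul_thetaTerm {m : ℕ} (hm : 0 < m) (u z : ℂ) (τ : ℍ) :
    ∑' p : ℤ × ℤ, RTerm m u τ p.2 * thetaTerm m z τ (p.2 + 2 * m * p.1) =
      ∑ l ∈ Finset.range (2 * m), RML m l u τ * thetaML m l z τ := by
  have hs : Summable fun p : ℤ × ℤ => RTerm m u τ p.1 * thetaTerm m z τ (p.1 + 2 * m * p.2) :=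
    (Equiv.prodComm ℤ ℤ).summable_iff.mpr (summable_RTerm_mul_thetaTerm hm u z τ)
  have hcomm : ∑' p : ℤ × ℤ, RTerm m u τ p.2 * thetaTerm m z τ (p.2 + 2 * m * p.1) =
      ∑' p : ℤ × ℤ, RTerm m u τ p.1 * thetaTerm m z τ (p.1 + 2 * m * p.2) :=
    ((Equiv.prodComm ℤ ℤ).tsum_eq _).symm
  have h0 : ∀ k : ℤ, ∑' n : ℤ, RTerm m u τ k * thetaTerm m z τ (k + 2 * m * n) =
      RTerm m u τ k * thetaML m k z τ := fun k => by rw [thetaML_eq hm, tsum_mul_left]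
  have hs' : Summable fun k : ℤ => RTerm m u τ k * thetaML m k z τ :=
    hs.prod.congr fun k => h0 k
  rw [hcomm, hs.tsum_prod]
  refine (tsum_congr fun k => h0 k).trans ?_
  exact (sum_tsum_residue_mul hm hs' fun k l hkl => thetaML_congr hkl z τ).symm

theorem summable_indefThetaTerm {m : ℕ} (hm : 0 < m) {u z : ℂ} {τ : ℍ}
    (h : ∀ n : ℤ, (z - u).im / τ.im ≠ n) :
    Summable (indefThetaTerm (blockA m) blockC₁ (blockC₂ m) ![z - u, 2 * m * u] τ) := by
  have h1 := (summable_geomTerm hm h).sub (summable_RTerm_mul_thetaTerm hm u z τ)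
  exact ((finTwoArrowEquiv ℤ).summable_iff.mpr h1).congr fun n =>
    (indefThetaTerm_eq hm u z τ n).symm

theorem fTilde_eq_indefTheta {m : ℕ} (hm : 0 < m) {u z : ℂ} {τ : ℍ}
    (h : ∀ n : ℤ, (z - u).im / τ.im ≠ n) :
    fTilde m u z τ = (1 / 2) *
      indefTheta (blockA m) blockC₁ (blockC₂ m) ![z - u, 2 * m * u] τ := by
  have h1 : indefTheta (blockA m) blockC₁ (blockC₂ m) ![z - u, 2 * m * u] τ =
      ∑' p : ℤ × ℤ, (geomTerm m u z τ p -
        RTerm m u τ p.2 * thetaTerm m z τ (p.2 + 2 * m * p.1)) := by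
    rw [← (finTwoArrowEquiv ℤ).tsum_eq]
    exact tsum_congr fun n => indefThetaTerm_eq hm u z τ n
  rw [h1, (summable_geomTerm hm h).tsum_sub (summable_RTerm_mul_thetaTerm hm u z τ),
    tsum_geomTerm hm h, tsum_RTerm_mul_thetaTerm hm, fTilde]
  ring

end MockTheta

theorem mainTheorem12 (m : ℕ) (hm : 0 < m) :
    -- the defining series converge absolutely
    (∀ (u z : ℂ) (τ : ℍ), z ∉ MockTheta.latticeCoset u τ →
      Summable (MockTheta.fTerm m u z τ)) ∧
    (∀ (l : ℤ) (z : ℂ) (τ : ℍ), Summable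
      (fun k : {k : ℤ // k ≡ l [ZMOD (2 * m : ℤ)]} => MockTheta.thetaTerm m z τ k)) ∧
    (∀ (l : ℤ) (u : ℂ) (τ : ℍ), Summable
      (fun k : {k : ℤ // k ≡ l [ZMOD (2 * m : ℤ)]} => MockTheta.RTerm m u τ k)) ∧
    -- (1a) the elliptic transformation law in `z`
    (∀ (u z : ℂ) (τ : ℍ), z ∉ MockTheta.latticeCoset u τ → ∀ k n : ℤ,
      MockTheta.fTilde m u (z + k * (τ : ℂ) + n) τ =
        Complex.exp (-(2 * Real.pi * Complex.I * m * (k ^ 2 * (τ : ℂ) + 2 * k * z))) *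
          MockTheta.fTilde m u z τ) ∧
    -- (1b) the elliptic transformation law in `u`
    (∀ (u z : ℂ) (τ : ℍ), z ∉ MockTheta.latticeCoset u τ → ∀ k n : ℤ,
      MockTheta.fTilde m (u + k * (τ : ℂ) + n) z τ =
        Complex.exp (2 * Real.pi * Complex.I * m * (k ^ 2 * (τ : ℂ) + 2 * k * u)) *
          MockTheta.fTilde m u z τ) ∧
    -- (1c) the modular transformation law
    (∀ (u z : ℂ) (τ : ℍ), z ∉ MockTheta.latticeCoset u τ → ∀ γ : SL(2, ℤ),
      MockTheta.fTilde m (u / ((γ 1 0 : ℂ) * τ + (γ 1 1 : ℂ)))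
          (z / ((γ 1 0 : ℂ) * τ + (γ 1 1 : ℂ))) (γ • τ) =
        ((γ 1 0 : ℂ) * τ + (γ 1 1 : ℂ)) *
          Complex.exp (2 * Real.pi * Complex.I * m * (γ 1 0 : ℂ) * (z ^ 2 - u ^ 2) /
            ((γ 1 0 : ℂ) * τ + (γ 1 1 : ℂ))) *
          MockTheta.fTilde m u z τ) ∧
    -- (2) meromorphy in `z`, with simple poles exactly on `u + ℤτ + ℤ`; residue at `u`
    (∀ (u : ℂ) (τ : ℍ),
      Meromorphic (fun z => MockTheta.fTilde m u z τ) ∧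
      (∀ z ∈ MockTheta.latticeCoset u τ,
        meromorphicOrderAt (fun z => MockTheta.fTilde m u z τ) z = (-1 : ℤ)) ∧
      (∀ z ∉ MockTheta.latticeCoset u τ,
        AnalyticAt ℂ (fun z => MockTheta.fTilde m u z τ) z) ∧
      Filter.Tendsto (fun z => (z - u) * MockTheta.fTilde m u z τ) (𝓝[≠] u)
        (𝓝 (-1 / (2 * Real.pi * Complex.I)))) ∧
    -- (3) the indefinite theta series: the data are admissible ...
    MockTheta.IsOfTypeOne (MockTheta.blockA m) ∧
    MockTheta.blockC₁ ∈ MockTheta.cuspS (MockTheta.blockA m) (MockTheta.blockC₂ m) ∧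
    MockTheta.blockC₂ m ∈ MockTheta.coneC (MockTheta.blockA m) (MockTheta.blockC₂ m) ∧
    -- ... its domain of definition is `Im (z - u) / Im τ ∉ ℤ` ...
    (∀ (u z : ℂ) (τ : ℍ),
      ((![z - u, 2 * m * u], τ) ∈ MockTheta.domainD (MockTheta.blockA m) MockTheta.blockC₁ ∩
          MockTheta.domainD (MockTheta.blockA m) (MockTheta.blockC₂ m) ↔
        ∀ n : ℤ, (z - u).im / τ.im ≠ n)) ∧
    -- ... and there it converges absolutely and represents the function
    (∀ (u z : ℂ) (τ : ℍ),
      (![z - u, 2 * m * u], τ) ∈ MockTheta.domainD (MockTheta.blockA m) MockTheta.blockC₁ ∩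
          MockTheta.domainD (MockTheta.blockA m) (MockTheta.blockC₂ m) →
        Summable (MockTheta.indefThetaTerm (MockTheta.blockA m) MockTheta.blockC₁
          (MockTheta.blockC₂ m) ![z - u, 2 * m * u] τ) ∧
        MockTheta.fTilde m u z τ =
          (1 / 2) * MockTheta.indefTheta (MockTheta.blockA m) MockTheta.blockC₁
            (MockTheta.blockC₂ m) ![z - u, 2 * m * u] τ) := by
  refine ⟨fun u z τ _ => MockTheta.summable_fTerm hm u z τ,
    fun l z τ => (MockTheta.summable_thetaTerm hm z τ).subtype _,
    fun l u τ => (MockTheta.summable_RTerm hm u τ).subtype _,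
    fun u z τ _ k n => MockTheta.fTilde_add_z hm u z τ k n,
    fun u z τ h k n => MockTheta.fTilde_add_u hm h k n,
    fun u z τ h γ => MockTheta.transformsUnder hm γ u z τ h,
    fun u τ => ⟨fun z => ?_, ?_, fun z h => MockTheta.analyticAt_fTilde_z hm h, ?_⟩,
    MockTheta.isOfTypeOne_blockA hm, MockTheta.blockC₁_mem_cuspS m,
    MockTheta.blockC₂_mem_coneC hm, MockTheta.mem_domainD_iff hm, fun u z τ h => ?_⟩
  · by_cases h : z ∈ MockTheta.latticeCoset u τ
    · obtain ⟨k, n, rfl⟩ := h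
      exact MockTheta.meromorphicAt_fTilde_z hm u τ k n
    · exact (MockTheta.analyticAt_fTilde_z hm h).meromorphicAt
  · rintro _ ⟨k, n, rfl⟩
    exact MockTheta.meromorphicOrderAt_fTilde_z hm u τ k n
  · simpa using MockTheta.tendsto_sub_mul_fTilde_z hm u τ 0 0
  · have h' := (MockTheta.mem_domainD_iff hm u z τ).mp h
    exact ⟨MockTheta.summable_indefThetaTerm hm h', MockTheta.fTilde_eq_indefTheta hm h'⟩
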